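/- All graphs are finite and simple. For a graph $G$ with adjacency matrix $A(G)$, the spread $s(G)$ is the largest minus the smallest eigenvalue of $A(G)$. A graph is $K_r$-minor-free if it does not contain the complete graph $K_r$ as a minor. The join $G_1\vee G_2$ is the disjoint union of $G_1$ and $G_2$ together with all edges between them, and $mK_1$ is the graph with $m$ vertices and no edges. Let $r\ge 3$. There are constants $C$ and $N$, depending only on $r$, such that the following holds for every $n\ge N$ and every graph $G$ that has the maximum spread among all $K_r$-minor-free graphs on $n$ vertices. There is a set $L$ of $r-2$ vertices of $G$ with $G=G[L]\vee (n-r+2)K_1$, and for every such $L$, writing $$\gamma=\sqrt{(r-2)(n-r+2)},\qquad \ell_1=\mathbf 1^{\mathrm T}A(G[L])\,\mathbf 1,\qquad \ell_2=\mathbf 1^{\mathrm T}A(G[L])^2\,\mathbf 1,$$ we have $$\left|\,s(G)-\left(2\gamma+\frac{1}{r-2}\left(-\frac{3}{4(r-2)}\ell_1^2+\ell_2\right)\frac1\gamma\right)\right|\le \frac{C}{\gamma^{3}} .$$ -/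

import Mathlib

open scoped Matrix

namespace SpreadMinor

/-- `H` is a minor of `G`: there are pairwise disjoint vertex sets of `G` (the branch sets, one for
each vertex of `H`), each inducing a connected (in particular nonempty) subgraph of `G`, such that
branch sets of adjacent vertices of `H` are joined by an edge of `G`.  Contracting the branch sets
and deleting the superfluous vertices and edges turns `G` into `H`. -/
def IsMinor {W V : Type*} (H : SimpleGraph W) (G : SimpleGraph V) : Prop :=
  ∃ B : W → Set V,
    (∀ w, (G.induce (B w)).Connected) ∧
    (∀ w w', w ≠ w' → Disjoint (B w) (B w')) ∧
    ∀ w w', H.Adj w w' → ∃ x ∈ B w, ∃ y ∈ B w', G.Adj x y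

/-- `G` does not contain the complete graph `K_r` as a minor. -/
def CompleteMinorFree (r : ℕ) {V : Type*} (G : SimpleGraph V) : Prop :=
  ¬ IsMinor (⊤ : SimpleGraph (Fin r)) G

open Classical in
/-- The real adjacency matrix of `G`. -/
noncomputable def adj {V : Type*} (G : SimpleGraph V) : Matrix V V ℝ :=
  G.adjMatrix ℝ

/-- The spread of `G`: the largest minus the smallest eigenvalue of its adjacency matrix.
The spectrum of a real matrix is the finite set of its real eigenvalues, and it is nonempty here
(when there is a vertex) because the adjacency matrix is symmetric. -/
noncomputable def spread {V : Type*} [Fintype V] [DecidableEq V]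
    (G : SimpleGraph V) : ℝ :=
  sSup (spectrum ℝ (adj G)) - sInf (spectrum ℝ (adj G))

/-- `G` has maximum spread among all `K_r`-minor-free graphs with `n` vertices. -/
def IsMaxSpread (r : ℕ) {n : ℕ} (G : SimpleGraph (Fin n)) : Prop :=
  CompleteMinorFree r G ∧
    ∀ H : SimpleGraph (Fin n), CompleteMinorFree r H → spread H ≤ spread G

/-- The join `G ∨ H`: the disjoint union of `G` and `H` together with all edges between them. -/
def join {V W : Type*} (G : SimpleGraph V) (H : SimpleGraph W) : SimpleGraph (V ⊕ W) :=
  (G ⊕g H) ⊔ completeBipartiteGraph V W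

/-- `L` is a set of `r - 2` vertices of `G` with `G = G[L] ∨ (n - r + 2) K_1`, where the first
factor of the join is `G[L]` sitting on the vertices of `L` themselves. -/
def IsJoinDecomposition (r : ℕ) {n : ℕ} (G : SimpleGraph (Fin n)) (L : Finset (Fin n)) : Prop :=
  L.card = r - 2 ∧
    ∃ e : join (G.induce (L : Set (Fin n))) (⊥ : SimpleGraph (Fin (n - (r - 2)))) ≃g G,
      ∀ x : (L : Set (Fin n)), e (Sum.inl x) = x

/-- `1ᵀ A(G)ᵏ 1`, where `1` is the all-ones vector. -/
noncomputable def onesForm {V : Type*} [Fintype V] [DecidableEq V]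
    (G : SimpleGraph V) (k : ℕ) : ℝ :=
  (fun _ : V => (1 : ℝ)) ⬝ᵥ ((adj G ^ k) *ᵥ (fun _ : V => (1 : ℝ)))

/-- `ℓ_k = 1ᵀ A(G[L])ᵏ 1`. -/
noncomputable def ell {n : ℕ} (G : SimpleGraph (Fin n)) (L : Finset (Fin n)) (k : ℕ) : ℝ :=
  onesForm (G.induce (L : Set (Fin n))) k

/-- `γ_{n,r} = √((r - 2)(n - r + 2))`. -/
noncomputable def gamma (n r : ℕ) : ℝ :=
  Real.sqrt (((r : ℝ) - 2) * ((n : ℝ) - r + 2))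

end SpreadMinor

open SpreadMinor

/-! Write k = r - 2 and γ = √(k(n-k)). Joining any graph on k vertices to n - k independent vertices
gives a K_r-minor-free graph of spread at least 2γ, so an extremal G has spread at least 2γ.
Everything else follows from this bound and from maximality.

Approximate structure (`exists_dominating_set`): K_r-minor-free graphs have linearly many edges, so
only boundedly many vertices are heavy (of degree at least a small multiple of n), and the light
part contributes at most a small multiple of √n to the quadratic form of a unit vector. Only
boundedly many light vertices have more than k heavy neighbours. A nonnegative unit vector of form
at least γ is then almost an equality case of Cauchy–Schwarz, which forces almost all vertices to
share the same k heavy neighbours. These form L.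

Exact structure (`exists_join_structure`): let W be the set of vertices outside L not joined to all
of L. Minor-freeness leaves only O(|W|) edges outside L. If W were nonempty, test vectors built from
the two extremal eigenvectors of G would show that the join on L has a strictly larger top
eigenvalue and a strictly smaller bottom one (`eigen_estimates`), against maximality.

Asymptotics (`spread_join_asymptotics`): for a join, eliminating the independent side leaves θp =
A(G[L])p + c·1 on L. Iterating this gives θ⁵ = (n-k)(kθ³ + ℓ₁θ² + ℓ₂θ + ℓ₃) up to O(γ) at the two
extreme eigenvalues. The root near γ is expanded to order γ⁻² (`quintic_root_asymptotics`). Minus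
the bottom eigenvalue solves the same equation with ℓ₁ and ℓ₃ negated, so in the sum of the two
roots the terms of order γ⁰ and γ⁻² cancel, leaving the stated formula with error O(γ⁻³). -/

namespace SpreadMinor

/-! ### Clique minors: linear edge bound, bicliques and joins -/

section Minors

open Classical

variable {V : Type*}

theorem reachable_of_forall_adj {W : Type*} {G : SimpleGraph V} {K : SimpleGraph W} (f : V → W)
    (h : ∀ a b, G.Adj a b → K.Reachable (f a) (f b)) {a b : V} (hab : G.Reachable a b) :
    K.Reachable (f a) (f b) := by
  obtain ⟨p⟩ := hab
  induction p with
  | nil => exact SimpleGraph.Reachable.refl _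
  | cons hadj _ ih => exact (h _ _ hadj).trans ih

/-- `K_r` is a minor of `G` with all branch sets inside `S`. -/
def CliqueMinorOn (r : ℕ) (G : SimpleGraph V) (S : Set V) : Prop :=
  ∃ B : Fin r → Set V, (∀ i, B i ⊆ S) ∧ (∀ i, (G.induce (B i)).Connected) ∧
    (∀ i j, i ≠ j → Disjoint (B i) (B j)) ∧
    ∀ i j, i ≠ j → ∃ x ∈ B i, ∃ y ∈ B j, G.Adj x y

theorem CliqueMinorOn.isMinor {r : ℕ} {G : SimpleGraph V} {S : Set V} (h : CliqueMinorOn r G S) :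
    IsMinor (⊤ : SimpleGraph (Fin r)) G := by
  obtain ⟨B, -, h1, h2, h3⟩ := h
  exact ⟨B, h1, h2, fun i j hij => h3 i j hij⟩

theorem isMinor_top_of_card {ι : Type*} [Fintype ι] {r : ℕ} {G : SimpleGraph V}
    (hr : Fintype.card ι = r) (B : ι → Set V) (h1 : ∀ i, (G.induce (B i)).Connected)
    (h2 : ∀ i j, i ≠ j → Disjoint (B i) (B j))
    (h3 : ∀ i j, i ≠ j → ∃ x ∈ B i, ∃ y ∈ B j, G.Adj x y) :
    IsMinor (⊤ : SimpleGraph (Fin r)) G := by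
  let e : Fin r ≃ ι := (Fintype.equivFinOfCardEq hr).symm
  exact ⟨fun i => B (e i), fun i => h1 _, fun i j hij => h2 _ _ (e.injective.ne hij),
    fun i j hij => h3 _ _ (e.injective.ne hij)⟩

/-- Contract the edge `uv` into `u`; the vertex `v` becomes isolated. -/
def contract (G : SimpleGraph V) (u v : V) : SimpleGraph V where
  Adj a b := a ≠ b ∧ a ≠ v ∧ b ≠ v ∧
    (G.Adj a b ∨ (a = u ∧ G.Adj v b) ∨ (b = u ∧ G.Adj v a))
  symm := ⟨by
    rintro a b ⟨h1, h2, h3, h4⟩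
    refine ⟨h1.symm, h3, h2, ?_⟩
    rcases h4 with h | h | h
    · exact Or.inl h.symm
    · exact Or.inr (Or.inr h)
    · exact Or.inr (Or.inl h)⟩
  loopless := ⟨fun a h => h.1 rfl⟩

theorem induce_connected_singleton (G : SimpleGraph V) (v : V) :
    (G.induce ({v} : Set V)).Connected := by
  have : Nonempty ({v} : Set V) := ⟨⟨v, rfl⟩⟩
  refine ⟨fun a b => ?_⟩
  rw [Subsingleton.elim a b]

theorem induce_connected_pair {G : SimpleGraph V} {u v : V} (h : u = v ∨ G.Adj u v) :
    (G.induce ({u, v} : Set V)).Connected := by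
  rcases h with rfl | h
  · rw [Set.pair_eq_singleton]
    exact induce_connected_singleton G u
  · exact SimpleGraph.induce_pair_connected_of_adj h

/-- Contraction is undone by putting v back into the branch set that contains u, if there is one. An
edge that the contraction created at u is then replaced by the path through v. -/
theorem CliqueMinorOn.of_contract {r : ℕ} {G : SimpleGraph V} {u v : V} {S : Set V}
    (huv : G.Adj u v) (hv : v ∈ S) (h : CliqueMinorOn r (contract G u v) (S \ {v})) :
    CliqueMinorOn r G S := by
  obtain ⟨B, h0, h1, h2, h3⟩ := h
  have hvB : ∀ i, v ∉ B i := fun i hi => (h0 i hi).2 rfl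
  let B' : Fin r → Set V := fun i => if u ∈ B i then insert v (B i) else B i
  have hsub : ∀ i, B i ⊆ B' i := by
    intro i
    by_cases hu : u ∈ B i
    · simp [B', hu, Set.subset_insert]
    · simp [B', hu]
  have hmem : ∀ i x, x ∈ B' i → x ∈ B i ∨ (x = v ∧ u ∈ B i) := by
    intro i x hx
    by_cases hu : u ∈ B i
    · simp only [B', hu, if_true, Set.mem_insert_iff] at hx
      tauto
    · simp only [B', hu, if_false] at hx
      exact Or.inl hx
  have hvB' : ∀ i, u ∈ B i → v ∈ B' i := by
    intro i hu
    simp [B', hu]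
  refine ⟨B', ?_, ?_, ?_, ?_⟩
  · intro i x hx
    rcases hmem i x hx with h | ⟨rfl, -⟩
    · exact (h0 i h).1
    · exact hv
  · intro i
    have key : ∀ a b : B i, ((contract G u v).induce (B i)).Adj a b →
        (G.induce (B' i)).Reachable ⟨a, hsub i a.2⟩ ⟨b, hsub i b.2⟩ := by
      rintro ⟨a, ha⟩ ⟨b, hb⟩ hab
      obtain ⟨-, -, -, h4⟩ := hab
      change G.Adj a b ∨ (a = u ∧ G.Adj v b) ∨ (b = u ∧ G.Adj v a) at h4
      rcases h4 with h | ⟨rfl, h⟩ | ⟨rfl, h⟩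
      · exact SimpleGraph.Adj.reachable (G := G.induce (B' i)) h
      · have e1 : (G.induce (B' i)).Adj ⟨a, hsub i ha⟩ ⟨v, hvB' i ha⟩ := huv
        have e2 : (G.induce (B' i)).Adj ⟨v, hvB' i ha⟩ ⟨b, hsub i hb⟩ := h
        exact e1.reachable.trans e2.reachable
      · have e1 : (G.induce (B' i)).Adj ⟨b, hsub i hb⟩ ⟨v, hvB' i hb⟩ := huv
        have e2 : (G.induce (B' i)).Adj ⟨v, hvB' i hb⟩ ⟨a, hsub i ha⟩ := h
        exact (e1.reachable.trans e2.reachable).symm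
    have key2 : ∀ a b : B i,
        (G.induce (B' i)).Reachable ⟨a, hsub i a.2⟩ ⟨b, hsub i b.2⟩ := fun a b =>
      reachable_of_forall_adj (fun a : B i => (⟨a, hsub i a.2⟩ : B' i)) key
        ((h1 i).preconnected a b)
    obtain ⟨x0⟩ := (h1 i).nonempty
    have : Nonempty (B' i) := ⟨⟨x0, hsub i x0.2⟩⟩
    have key3 : ∀ a : B' i, (G.induce (B' i)).Reachable a ⟨x0, hsub i x0.2⟩ := by
      rintro ⟨a, ha⟩
      rcases hmem i a ha with h | ⟨rfl, hu⟩
      · exact key2 ⟨a, h⟩ x0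
      · have e1 : (G.induce (B' i)).Adj ⟨a, ha⟩ ⟨u, hsub i hu⟩ := huv.symm
        exact e1.reachable.trans (key2 ⟨u, hu⟩ x0)
    exact ⟨fun a b => (key3 a).trans (key3 b).symm⟩
  · intro i j hij
    rw [Set.disjoint_left]
    intro x hx hx'
    have hd := Set.disjoint_left.mp (h2 i j hij)
    rcases hmem i x hx with h | ⟨rfl, hu⟩ <;> rcases hmem j x hx' with h' | ⟨h'', hu'⟩
    · exact hd h h'
    · exact hvB i (h'' ▸ h)
    · exact hvB j h'
    · exact hd hu hu'
  · intro i j hij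
    obtain ⟨x, hx, y, hy, -, -, -, h4⟩ := h3 i j hij
    rcases h4 with h | ⟨rfl, h⟩ | ⟨rfl, h⟩
    · exact ⟨x, hsub i hx, y, hsub j hy, h⟩
    · exact ⟨v, hvB' i hx, y, hsub j hy, h⟩
    · exact ⟨x, hsub i hx, v, hvB' j hy, h.symm⟩

/-- Twice the number of edges of `G` inside `S`. -/
noncomputable def pairs (G : SimpleGraph V) (S : Finset V) : ℕ :=
  ∑ v ∈ S, (S.filter (G.Adj v)).card

/-- Contraction loses the edge uv and one edge for each common neighbour; every other edge at v is
moved to u (the set `X`). Each edge counts twice in `pairs`. -/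
theorem pairs_erase_le (G : SimpleGraph V) {S : Finset V} {u v : V} (hu : u ∈ S) (hv : v ∈ S)
    (huv : G.Adj u v) :
    pairs G S ≤ pairs (contract G u v) (S.erase v) +
      (2 + 2 * (S.filter fun w => G.Adj u w ∧ G.Adj v w).card) := by
  set S' := S.erase v with hS'
  set X := S'.filter (fun x => x ≠ u ∧ G.Adj v x ∧ ¬ G.Adj u x) with hX
  set D := S'.filter (fun x => G.Adj v x) with hD
  have hvS' : v ∉ S' := by simp [hS']
  have hS : S = insert v S' := (Finset.insert_erase hv).symm
  have huS' : u ∈ S' := Finset.mem_erase.mpr ⟨huv.ne, hu⟩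
  have h1 : pairs G S = pairs G S' + 2 * D.card := by
    have e1 : ∀ a ∈ S', (S.filter (G.Adj a)).card =
        (S'.filter (G.Adj a)).card + if G.Adj v a then 1 else 0 := by
      intro a _
      rw [hS, Finset.filter_insert, G.adj_comm v a]
      split_ifs with h
      · rw [Finset.card_insert_of_notMem (by simp [hvS'])]
      · rfl
    have e2 : (S.filter (G.Adj v)).card = D.card := by
      rw [hS, Finset.filter_insert, if_neg (G.loopless.irrefl v)]
    have e3 : pairs G S = (S.filter (G.Adj v)).card + ∑ a ∈ S', (S.filter (G.Adj a)).card := by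
      unfold pairs
      conv_lhs => rw [hS]
      rw [Finset.sum_insert hvS', ← hS]
    rw [e3, e2, Finset.sum_congr rfl e1, Finset.sum_add_distrib, Finset.sum_boole]
    simp only [pairs, hD, Nat.cast_id]
    ring
  have h2 : D.card ≤ 1 + (S.filter fun w => G.Adj u w ∧ G.Adj v w).card + X.card := by
    have : D ⊆ ({u} ∪ (S.filter fun w => G.Adj u w ∧ G.Adj v w)) ∪ X := by
      intro x hx
      simp only [hD, hX, hS', Finset.mem_filter, Finset.mem_union, Finset.mem_singleton,
        Finset.mem_erase] at hx ⊢
      tauto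
    refine (Finset.card_le_card this).trans ((Finset.card_union_le _ _).trans ?_)
    gcongr
    refine (Finset.card_union_le _ _).trans ?_
    simp
  have h3 : pairs G S' + 2 * X.card ≤ pairs (contract G u v) S' := by
    have e1 : ∀ a ∈ S', (S'.filter (G.Adj a)).card + ((if a ∈ X then 1 else 0) +
        if a = u then X.card else 0) ≤ (S'.filter ((contract G u v).Adj a)).card := by
      intro a ha
      have hav : a ≠ v := fun h => hvS' (h ▸ ha)
      by_cases hau : a = u
      · subst hau
        have haX : a ∉ X := by simp [hX]
        rw [if_neg haX, if_pos rfl, zero_add, ← Finset.card_union_of_disjoint]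
        · apply Finset.card_le_card
          intro x hx
          simp only [hX, hS', Finset.mem_filter, Finset.mem_union, Finset.mem_erase] at hx
          simp only [hS', Finset.mem_filter, Finset.mem_erase, contract]
          rcases hx with ⟨h, h'⟩ | ⟨h, h', h''⟩
          · exact ⟨h, h'.ne, hav, h.1, Or.inl h'⟩
          · exact ⟨h, h'.symm, hav, h.1, Or.inr (Or.inl ⟨trivial, h''.1⟩)⟩
        · rw [Finset.disjoint_left]
          intro x hx
          simp only [Finset.mem_filter] at hx
          simp [hX, hx.2]
      · rw [if_neg hau, add_zero]
        split_ifs with haX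
        · have hu' : u ∉ S'.filter (G.Adj a) := by
            simp only [hX, Finset.mem_filter] at haX
            simp only [Finset.mem_filter, G.adj_comm a u]
            tauto
          rw [← Finset.card_insert_of_notMem hu']
          apply Finset.card_le_card
          intro x hx
          simp only [hX, hS', Finset.mem_filter, Finset.mem_insert, Finset.mem_erase] at hx haX
          simp only [hS', Finset.mem_filter, Finset.mem_erase, contract]
          rcases hx with rfl | ⟨h, h'⟩
          · exact ⟨⟨huv.ne, hu⟩, hau, hav, huv.ne, Or.inr (Or.inr ⟨rfl, haX.2.2.1⟩)⟩
          · exact ⟨h, h'.ne, hav, h.1, Or.inl h'⟩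
        · rw [add_zero]
          apply Finset.card_le_card
          intro x hx
          simp only [hS', Finset.mem_filter, Finset.mem_erase] at hx
          simp only [hS', Finset.mem_filter, Finset.mem_erase, contract]
          exact ⟨hx.1, hx.2.ne, hav, hx.1.1, Or.inl hx.2⟩
    have e2 := Finset.sum_le_sum e1
    rw [Finset.sum_add_distrib, Finset.sum_add_distrib, Finset.sum_boole, Finset.sum_ite_eq',
      if_pos huS'] at e2
    have e3 : S'.filter (fun a => a ∈ X) = X := by
      ext x
      simp only [hX, Finset.mem_filter]
      tauto
    rw [e3] at e2
    simp only [pairs, Nat.cast_id] at e2 ⊢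
    omega
  omega

/-- A graph that is dense enough on `S` has a `K_r` minor inside `S`. -/
theorem exists_cliqueMinorOn (r : ℕ) : ∃ c : ℕ, ∀ (n : ℕ) {V : Type} (G : SimpleGraph V)
    (S : Finset V), S.card = n → S.Nonempty → c * S.card ≤ pairs G S →
    CliqueMinorOn r G (S : Set V) := by
  induction r with
  | zero =>
    refine ⟨0, fun n V G S _ _ _ => ⟨fun i => i.elim0, ?_, ?_, ?_, ?_⟩⟩ <;> intro i <;>
      exact i.elim0
  | succ r ih =>
    obtain ⟨c, hc⟩ := ih
    -- Contracting an edge with at most c common neighbours costs one vertex and at most 2c + 2 in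
    -- `pairs`, so the density hypothesis survives.
    refine ⟨2 * c + 2, fun n => ?_⟩
    induction n with
    | zero =>
      intro V G S h0 hS
      simp_all
    | succ n ihn =>
      intro V G S hcard hS hE
      by_cases hex : ∃ u ∈ S, ∃ v ∈ S, G.Adj u v ∧
          (S.filter fun w => G.Adj u w ∧ G.Adj v w).card ≤ c
      · obtain ⟨u, hu, v, hv, huv, hle⟩ := hex
        have h1 := pairs_erase_le G hu hv huv
        have hce : (S.erase v).card = n := by rw [Finset.card_erase_of_mem hv, hcard]; rfl
        have hne : (S.erase v).Nonempty := ⟨u, Finset.mem_erase.mpr ⟨huv.ne, hu⟩⟩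
        have := ihn (contract G u v) (S.erase v) hce hne (by
          rw [hcard] at hE; rw [hce]; nlinarith)
        rw [Finset.coe_erase] at this
        exact this.of_contract huv hv
      -- Every edge now has more than c common neighbours. Hence the neighbourhood of a non-isolated
      -- vertex v is dense enough for a K_r minor, and {v} is the additional branch set.
      · push Not at hex
        have hpos : 0 < pairs G S := by
          have : 0 < S.card := hS.card_pos
          nlinarith
        obtain ⟨v, hv, hv'⟩ : ∃ v ∈ S, 0 < (S.filter (G.Adj v)).card := by
          by_contra hcon
          push Not at hcon
          have : pairs G S = 0 := Finset.sum_eq_zero fun v hv => Nat.le_zero.mp (hcon v hv)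
          omega
        set N := S.filter (G.Adj v) with hN
        have hmin : c * N.card ≤ pairs G N := by
          rw [pairs, mul_comm, ← smul_eq_mul]
          apply Finset.card_nsmul_le_sum
          intro u hu
          rw [hN, Finset.mem_filter] at hu
          refine (hex v hv u hu.1 hu.2).le.trans (Finset.card_le_card ?_)
          intro w hw
          simp only [hN, Finset.mem_filter] at hw ⊢
          tauto
        obtain ⟨B, b0, b1, b2, b3⟩ := hc _ G N rfl (Finset.card_pos.mp hv') hmin
        have hvB : ∀ i, v ∉ B i := fun i hi => by
          have := b0 i hi
          simp [hN] at this
        refine ⟨Fin.cons {v} B, ?_, ?_, ?_, ?_⟩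
        · intro i
          refine Fin.cases ?_ (fun i => ?_) i
          · simpa using hv
          · simp only [Fin.cons_succ]
            exact (b0 i).trans (by simp only [hN, Finset.coe_subset, Finset.filter_subset])
        · intro i
          refine Fin.cases ?_ (fun i => ?_) i
          · exact induce_connected_singleton G v
          · exact b1 i
        · intro i j
          refine Fin.cases ?_ (fun i => ?_) i <;> refine Fin.cases ?_ (fun j => ?_) j
          · simp
          · intro _
            simpa using hvB j
          · intro _
            simpa using hvB i
          · intro hij
            exact b2 i j (fun h => hij (h ▸ rfl))
        · have hadj : ∀ i, ∃ y ∈ B i, G.Adj v y := by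
            intro i
            obtain ⟨y⟩ := (b1 i).nonempty
            have := b0 i y.2
            simp only [hN, Finset.coe_filter, Set.mem_ofPred_eq] at this
            exact ⟨y, y.2, this.2⟩
          intro i j
          refine Fin.cases ?_ (fun i => ?_) i <;> refine Fin.cases ?_ (fun j => ?_) j
          · simp
          · intro _
            obtain ⟨y, hy, h⟩ := hadj j
            exact ⟨v, rfl, y, hy, h⟩
          · intro _
            obtain ⟨y, hy, h⟩ := hadj i
            exact ⟨y, hy, v, rfl, h.symm⟩
          · intro hij
            exact b3 i j (fun h => hij (h ▸ rfl))

theorem CompleteMinorFree.exists_pairs_lt (r : ℕ) : ∃ c : ℕ, ∀ {V : Type} (G : SimpleGraph V),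
    CompleteMinorFree r G → ∀ S : Finset V, S.Nonempty → pairs G S < c * S.card := by
  obtain ⟨c, hc⟩ := exists_cliqueMinorOn r
  refine ⟨c, fun G hG S hS => ?_⟩
  by_contra hcon
  exact hG (hc _ G S rfl hS (not_lt.mp hcon)).isMinor

/-- A `K_{k+2}` minor from a biclique `l_i t_j` and two further adjacent branch sets `{a}` and
`{b, v}`. -/
theorem isMinor_of_biclique {k r : ℕ} (hr : k + 2 = r) {G : SimpleGraph V} (l t : Fin k → V)
    (a b v : V) (hl : l.Injective) (ht : t.Injective) (hlt : ∀ i j, G.Adj (l i) (t j))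
    (ha : ∀ i, G.Adj a (l i) ∨ G.Adj a (t i)) (hb : ∀ i, G.Adj b (l i) ∨ G.Adj b (t i))
    (hbv : b = v ∨ G.Adj b v) (hav : G.Adj a v) (hab : a ≠ b)
    (hal : ∀ i, a ≠ l i) (hat : ∀ i, a ≠ t i) (hbl : ∀ i, b ≠ l i) (hbt : ∀ i, b ≠ t i)
    (hvl : ∀ i, v ≠ l i) (hvt : ∀ i, v ≠ t i) :
    IsMinor (⊤ : SimpleGraph (Fin r)) G := by
  have hlt' : ∀ i j, l i ≠ t j := fun i j => (hlt i j).ne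
  let B : Option (Option (Fin k)) → Set V := fun o =>
    match o with
    | none => {a}
    | some none => {b, v}
    | some (some i) => {l i, t i}
  refine isMinor_top_of_card (ι := Option (Option (Fin k))) (by simp [← hr]) B ?_ ?_ ?_
  · rintro (_ | _ | i)
    · exact induce_connected_singleton G a
    · exact induce_connected_pair hbv
    · exact induce_connected_pair (Or.inr (hlt i i))
  · have hs : ∀ o o' : Option (Option (Fin k)), o ≠ o' → ∀ x ∈ B o, x ∉ B o' := by
      have := hav.ne
      rintro (_ | _ | i) (_ | _ | j) hij x hx hx' <;>
        simp only [B, Set.mem_insert_iff, Set.mem_singleton_iff] at hx hx'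
      all_goals first
        | exact hij rfl
        | skip
      · grind
      · grind
      · grind
      · grind
      · grind
      · grind
      · have hne : i ≠ j := fun h => hij (h ▸ rfl)
        have h1 := hl.ne hne
        have h2 := ht.ne hne
        have h3 := hlt' i j
        have h4 := hlt' j i
        grind
    intro i j hij
    exact Set.disjoint_left.mpr (fun x hx => hs i j hij x hx)
  · have hs : ∀ o i, ∃ x ∈ B o, o ≠ some (some i) → ∃ y ∈ B (some (some i)), G.Adj x y := by
      rintro (_ | _ | i) j
      · refine ⟨a, rfl, fun _ => ?_⟩
        rcases ha j with h | h
        · exact ⟨l j, Or.inl rfl, h⟩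
        · exact ⟨t j, Or.inr rfl, h⟩
      · refine ⟨b, Or.inl rfl, fun _ => ?_⟩
        rcases hb j with h | h
        · exact ⟨l j, Or.inl rfl, h⟩
        · exact ⟨t j, Or.inr rfl, h⟩
      · exact ⟨l i, Or.inl rfl, fun _ => ⟨t j, Or.inr rfl, hlt i j⟩⟩
    have hs' : ∀ o i, o ≠ some (some i) → ∃ x ∈ B o, ∃ y ∈ B (some (some i)), G.Adj x y := by
      intro o i h
      obtain ⟨x, hx, h'⟩ := hs o i
      exact ⟨x, hx, h' h⟩
    rintro o (_ | _ | j) hne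
    · rcases o with (_ | _ | i)
      · exact absurd rfl hne
      · exact ⟨v, Or.inr rfl, a, rfl, hav.symm⟩
      · obtain ⟨x, hx, y, hy, h⟩ := hs' none i (by simp)
        exact ⟨y, hy, x, hx, h.symm⟩
    · rcases o with (_ | _ | i)
      · exact ⟨a, rfl, v, Or.inr rfl, hav⟩
      · exact absurd rfl hne
      · obtain ⟨x, hx, y, hy, h⟩ := hs' (some none) i (by simp)
        exact ⟨y, hy, x, hx, h.symm⟩
    · exact hs' o j hne

/-- Keep `G` inside `L`, join `L` completely to its complement, and make the complement
independent. -/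
def joinOn (G : SimpleGraph V) (L : Finset V) : SimpleGraph V where
  Adj a b := (a ∈ L ∧ b ∈ L ∧ G.Adj a b) ∨ (a ∈ L ∧ b ∉ L) ∨ (a ∉ L ∧ b ∈ L)
  symm := ⟨fun a b h => by
    have := G.adj_comm a b
    tauto⟩
  loopless := ⟨fun a h => by
    have := G.loopless.irrefl a
    tauto⟩

/-- By disjointness at most k branch sets meet L. At most one avoids L, since the complement is
independent and two such sets could not be adjacent. This accounts for at most k + 1 sets. -/
theorem joinOn_completeMinorFree {k r : ℕ} (hr : k + 2 = r) (G : SimpleGraph V) (L : Finset V)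
    (hL : L.card = k) : CompleteMinorFree r (joinOn G L) := by
  rintro ⟨B, -, h2, h3⟩
  let U : Finset (Fin r) := Finset.univ.filter fun i => ∃ x ∈ B i, x ∈ L
  have hU : U.card ≤ k := by
    have : ∀ i : Fin r, ∃ x, i ∈ U → x ∈ B i ∧ x ∈ L := by
      intro i
      by_cases hi : i ∈ U
      · obtain ⟨x, hx⟩ := (Finset.mem_filter.mp hi).2
        exact ⟨x, fun _ => hx⟩
      -- Indices outside U need a default vertex; V cannot be empty, because two branch sets are
      -- joined by an edge.
      · by_cases hne : Nonempty V
        · exact ⟨hne.some, fun h => absurd h hi⟩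
        · obtain ⟨x, -⟩ := h3 ⟨0, by omega⟩ ⟨1, by omega⟩ (by simp)
          exact absurd ⟨x⟩ hne
    choose f hf using this
    rw [← hL]
    refine Finset.card_le_card_of_injOn f (fun i hi => (hf i hi).2) ?_
    intro i hi j hj hij
    by_contra hne
    exact Set.disjoint_left.mp (h2 i j hne) (hf i hi).1 (hij ▸ (hf j hj).1)
  have hUc : (Finset.univ \ U).card ≤ 1 := by
    rw [Finset.card_le_one]
    intro i hi j hj
    by_contra hne
    obtain ⟨x, hx, y, hy, h⟩ := h3 i j hne
    simp only [U, Finset.mem_sdiff, Finset.mem_univ, Finset.mem_filter, true_and] at hi hj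
    have h1 : x ∉ L := fun h' => hi ⟨x, hx, h'⟩
    have h2 : y ∉ L := fun h' => hj ⟨y, hy, h'⟩
    simp [joinOn, h1, h2] at h
  have := Finset.card_sdiff_add_card_eq_card (Finset.subset_univ U)
  simp at this
  omega

end Minors

/-! ### Entries of the adjacency matrix -/

section Adjacency

variable {V : Type*}

open Classical in
theorem adj_apply (G : SimpleGraph V) (u v : V) : adj G u v = if G.Adj u v then 1 else 0 := by
  simp [adj, SimpleGraph.adjMatrix_apply]

theorem adj_of_adj {G : SimpleGraph V} {u v : V} (h : G.Adj u v) : adj G u v = 1 := by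
  rw [adj_apply, if_pos h]

theorem adj_of_not_adj {G : SimpleGraph V} {u v : V} (h : ¬ G.Adj u v) : adj G u v = 0 := by
  rw [adj_apply, if_neg h]

theorem adj_isHermitian (G : SimpleGraph V) : (adj G).IsHermitian := by
  ext u v
  classical
  simp [adj_apply, G.adj_comm]

theorem adj_symm (G : SimpleGraph V) (u v : V) : adj G u v = adj G v u := by
  classical
  simp [adj_apply, G.adj_comm]

theorem adj_nonneg (G : SimpleGraph V) (u v : V) : 0 ≤ adj G u v := by
  classical
  rw [adj_apply]
  split_ifs <;> norm_num

theorem adj_le_one (G : SimpleGraph V) (u v : V) : adj G u v ≤ 1 := by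
  classical
  rw [adj_apply]
  split_ifs <;> norm_num

end Adjacency

/-! ### Rayleigh quotients and test vectors for joins -/

section Spectral

variable {V : Type*} [Fintype V] [DecidableEq V]

theorem spectrum_finite (A : Matrix V V ℝ) : (spectrum ℝ A).Finite :=
  Matrix.finite_spectrum A

theorem exists_eigenvector {A : Matrix V V ℝ} {θ : ℝ} (h : θ ∈ spectrum ℝ A) :
    ∃ x : V → ℝ, x ≠ 0 ∧ A *ᵥ x = θ • x := by
  rw [spectrum.mem_iff, Matrix.isUnit_iff_isUnit_det, isUnit_iff_ne_zero, not_not] at h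
  obtain ⟨x, hx, h⟩ := Matrix.exists_mulVec_eq_zero_iff.mpr h
  refine ⟨x, hx, ?_⟩
  rw [Matrix.sub_mulVec, Algebra.algebraMap_eq_smul_one, Matrix.smul_mulVec, Matrix.one_mulVec,
    sub_eq_zero] at h
  exact h.symm

/-- The c i are the coordinates of x in an orthonormal eigenbasis; both Rayleigh inequalities then
hold term by term. -/
theorem quadForm_eq_sum {A : Matrix V V ℝ} (hA : A.IsHermitian) (x : V → ℝ) :
    ∃ c : V → ℝ, x ⬝ᵥ x = ∑ i, c i ^ 2 ∧ x ⬝ᵥ A *ᵥ x = ∑ i, hA.eigenvalues i * c i ^ 2 := by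
  set U : Matrix V V ℝ := (hA.eigenvectorUnitary : Matrix V V ℝ) with hU
  have hUU : U * Uᵀ = 1 := by
    have := Unitary.mul_star_self_of_mem hA.eigenvectorUnitary.2
    rwa [Matrix.star_eq_conjTranspose, Matrix.conjTranspose_eq_transpose_of_trivial] at this
  have hspec : A = U * Matrix.diagonal hA.eigenvalues * Uᵀ := by
    conv_lhs => rw [hA.spectral_theorem, Unitary.conjStarAlgAut_apply]
    rw [Matrix.star_eq_conjTranspose, Matrix.conjTranspose_eq_transpose_of_trivial]
    rfl
  refine ⟨Uᵀ *ᵥ x, ?_, ?_⟩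
  · calc x ⬝ᵥ x = x ⬝ᵥ (U * Uᵀ) *ᵥ x := by rw [hUU, Matrix.one_mulVec]
      _ = (Uᵀ *ᵥ x) ⬝ᵥ (Uᵀ *ᵥ x) := by
        rw [← Matrix.mulVec_mulVec, Matrix.dotProduct_mulVec, ← Matrix.mulVec_transpose]
      _ = _ := by simp only [dotProduct, sq]
  · calc x ⬝ᵥ A *ᵥ x
        = x ⬝ᵥ (U * Matrix.diagonal hA.eigenvalues * Uᵀ) *ᵥ x := by rw [← hspec]
      _ = (Uᵀ *ᵥ x) ⬝ᵥ (Matrix.diagonal hA.eigenvalues *ᵥ (Uᵀ *ᵥ x)) := by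
        rw [← Matrix.mulVec_mulVec, ← Matrix.mulVec_mulVec, Matrix.dotProduct_mulVec,
          ← Matrix.mulVec_transpose]
      _ = _ := by
        simp only [dotProduct, Matrix.mulVec_diagonal]
        exact Finset.sum_congr rfl fun i _ => by ring

theorem spectrum_nonempty [Nonempty V] {A : Matrix V V ℝ} (hA : A.IsHermitian) :
    (spectrum ℝ A).Nonempty := by
  rw [hA.spectrum_real_eq_range_eigenvalues]
  exact Set.range_nonempty _

theorem le_sSup_spectrum {A : Matrix V V ℝ} (hA : A.IsHermitian) (x : V → ℝ) :
    x ⬝ᵥ A *ᵥ x ≤ sSup (spectrum ℝ A) * (x ⬝ᵥ x) := by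
  obtain ⟨c, h1, h2⟩ := quadForm_eq_sum hA x
  rw [h1, h2, Finset.mul_sum]
  refine Finset.sum_le_sum fun i _ => mul_le_mul_of_nonneg_right ?_ (sq_nonneg _)
  exact le_csSup (spectrum_finite A).bddAbove
    (hA.spectrum_real_eq_range_eigenvalues ▸ Set.mem_range_self i)

theorem sInf_spectrum_le {A : Matrix V V ℝ} (hA : A.IsHermitian) (x : V → ℝ) :
    sInf (spectrum ℝ A) * (x ⬝ᵥ x) ≤ x ⬝ᵥ A *ᵥ x := by
  obtain ⟨c, h1, h2⟩ := quadForm_eq_sum hA x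
  rw [h1, h2, Finset.mul_sum]
  refine Finset.sum_le_sum fun i _ => mul_le_mul_of_nonneg_right ?_ (sq_nonneg _)
  exact csInf_le (spectrum_finite A).bddBelow
    (hA.spectrum_real_eq_range_eigenvalues ▸ Set.mem_range_self i)

theorem exists_eigenvector_sSup [Nonempty V] {A : Matrix V V ℝ} (hA : A.IsHermitian) :
    ∃ x : V → ℝ, x ≠ 0 ∧ A *ᵥ x = sSup (spectrum ℝ A) • x :=
  exists_eigenvector ((spectrum_nonempty hA).csSup_mem (spectrum_finite A))

theorem exists_eigenvector_sInf [Nonempty V] {A : Matrix V V ℝ} (hA : A.IsHermitian) :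
    ∃ x : V → ℝ, x ≠ 0 ∧ A *ᵥ x = sInf (spectrum ℝ A) • x :=
  exists_eigenvector ((spectrum_nonempty hA).csInf_mem (spectrum_finite A))

/-- The quadratic form of the adjacency matrix as a double sum. -/
theorem quadForm_adj {V : Type*} [Fintype V] (G : SimpleGraph V) (x : V → ℝ) :
    x ⬝ᵥ adj G *ᵥ x = ∑ u, ∑ v, adj G u v * (x u * x v) := by
  simp only [dotProduct, Matrix.mulVec, Finset.mul_sum]
  exact Finset.sum_congr rfl fun u _ => Finset.sum_congr rfl fun v _ => by ring

theorem dotProduct_self_pos {V : Type*} [Fintype V] {x : V → ℝ} (hx : x ≠ 0) : 0 < x ⬝ᵥ x := by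
  have h1 : 0 ≤ x ⬝ᵥ x := Finset.sum_nonneg fun i _ => mul_self_nonneg _
  exact lt_of_le_of_ne h1 (fun h => hx (dotProduct_self_eq_zero.mp h.symm))

/-- Split a double sum along a vertex set and its complement. -/
theorem sum_sum_split (L : Finset V) (f : V → V → ℝ) :
    ∑ u, ∑ v, f u v = ∑ u ∈ L, ∑ v ∈ L, f u v + ∑ u ∈ L, ∑ v ∈ Lᶜ, f u v +
      ∑ u ∈ Lᶜ, ∑ v ∈ L, f u v + ∑ u ∈ Lᶜ, ∑ v ∈ Lᶜ, f u v := by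
  have h : ∀ u, ∑ v, f u v = ∑ v ∈ L, f u v + ∑ v ∈ Lᶜ, f u v :=
    fun u => (Finset.sum_add_sum_compl L _).symm
  rw [← Finset.sum_add_sum_compl L]
  simp only [h, Finset.sum_add_distrib]
  ring

theorem quadForm_joinOn (G : SimpleGraph V) (L : Finset V) (x : V → ℝ) (q : ℝ)
    (hx : ∀ v ∉ L, x v = q) :
    x ⬝ᵥ adj (joinOn G L) *ᵥ x =
      ∑ u ∈ L, ∑ v ∈ L, adj G u v * (x u * x v) + 2 * ((Lᶜ.card : ℝ) * q * ∑ u ∈ L, x u) := by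
  rw [quadForm_adj, sum_sum_split L]
  have h1 : ∑ u ∈ L, ∑ v ∈ L, adj (joinOn G L) u v * (x u * x v) =
      ∑ u ∈ L, ∑ v ∈ L, adj G u v * (x u * x v) := by
    refine Finset.sum_congr rfl fun u hu => Finset.sum_congr rfl fun v hv => ?_
    by_cases h : G.Adj u v
    · rw [adj_of_adj h, adj_of_adj (by simp [joinOn, hu, hv, h])]
    · rw [adj_of_not_adj h, adj_of_not_adj (by simp [joinOn, hu, hv, h])]
  have h2 : ∑ u ∈ L, ∑ v ∈ Lᶜ, adj (joinOn G L) u v * (x u * x v) =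
      (Lᶜ.card : ℝ) * q * ∑ u ∈ L, x u := by
    rw [Finset.mul_sum]
    refine Finset.sum_congr rfl fun u hu => ?_
    rw [mul_assoc, ← nsmul_eq_mul, ← Finset.sum_const]
    refine Finset.sum_congr rfl fun v hv => ?_
    rw [Finset.mem_compl] at hv
    rw [adj_of_adj (by simp [joinOn, hu, hv]), hx v hv]
    ring
  have h3 : ∑ u ∈ Lᶜ, ∑ v ∈ L, adj (joinOn G L) u v * (x u * x v) =
      (Lᶜ.card : ℝ) * q * ∑ u ∈ L, x u := by
    rw [← h2, Finset.sum_comm]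
    refine Finset.sum_congr rfl fun u _ => Finset.sum_congr rfl fun v _ => ?_
    rw [adj_symm, mul_comm (x u)]
  have h4 : ∑ u ∈ Lᶜ, ∑ v ∈ Lᶜ, adj (joinOn G L) u v * (x u * x v) = 0 := by
    refine Finset.sum_eq_zero fun u hu => Finset.sum_eq_zero fun v hv => ?_
    rw [Finset.mem_compl] at hu hv
    rw [adj_of_not_adj (by simp [joinOn, hu, hv]), zero_mul]
  rw [h1, h2, h3, h4]
  ring

theorem dotProduct_self_of_const (L : Finset V) (x : V → ℝ) (q : ℝ) (hx : ∀ v ∉ L, x v = q) :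
    x ⬝ᵥ x = ∑ u ∈ L, x u ^ 2 + (Lᶜ.card : ℝ) * q ^ 2 := by
  rw [dotProduct, ← Finset.sum_add_sum_compl L, ← nsmul_eq_mul, ← Finset.sum_const]
  congr 1
  · exact Finset.sum_congr rfl fun u _ => by ring
  · refine Finset.sum_congr rfl fun v hv => ?_
    rw [hx v (Finset.mem_compl.mp hv)]
    ring

/-- Bounds on the extreme eigenvalues of a join from test vectors that are constant on each side. -/
theorem joinOn_extreme_bounds (G : SimpleGraph V) (L : Finset V) (hL : 0 < L.card)
    (hL' : 0 < Lᶜ.card) :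
    (∑ u ∈ L, ∑ v ∈ L, adj G u v) / (2 * L.card) + √((L.card : ℝ) * (Lᶜ.card : ℝ)) ≤
      sSup (spectrum ℝ (adj (joinOn G L))) ∧
    sInf (spectrum ℝ (adj (joinOn G L))) ≤
      (∑ u ∈ L, ∑ v ∈ L, adj G u v) / (2 * L.card) - √((L.card : ℝ) * (Lᶜ.card : ℝ)) := by
  set k : ℝ := (L.card : ℝ) with hk
  set m : ℝ := (Lᶜ.card : ℝ) with hm
  have hk0 : 0 < k := Nat.cast_pos.mpr hL
  have hm0 : 0 < m := Nat.cast_pos.mpr hL'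
  set a := √k with ha
  set b := √m with hb
  have ha0 : 0 < a := Real.sqrt_pos.mpr hk0
  have hb0 : 0 < b := Real.sqrt_pos.mpr hm0
  have ha2 : a ^ 2 = k := Real.sq_sqrt hk0.le
  have hb2 : b ^ 2 = m := Real.sq_sqrt hm0.le
  set e := ∑ u ∈ L, ∑ v ∈ L, adj G u v with he
  -- The test vector is √m on L and q = ±√k off L, so that both sides carry the same mass km.
  have key : ∀ q : ℝ, q ^ 2 = k → ∃ x : V → ℝ, x ⬝ᵥ x = 2 * (k * m) ∧
      x ⬝ᵥ adj (joinOn G L) *ᵥ x = m * e + 2 * (m * q * (k * b)) := by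
    intro q hq
    refine ⟨fun v => if v ∈ L then b else q, ?_, ?_⟩
    · rw [dotProduct_self_of_const L _ q (fun v hv => if_neg hv), hq,
        Finset.sum_congr rfl (g := fun _ => m) (fun u hu => by rw [if_pos hu, hb2])]
      rw [Finset.sum_const, nsmul_eq_mul]
      ring
    · rw [quadForm_joinOn G L _ q (fun v hv => if_neg hv)]
      have e1 : ∑ u ∈ L, (if u ∈ L then b else q) = k * b := by
        rw [hk, ← nsmul_eq_mul, ← Finset.sum_const]
        exact Finset.sum_congr rfl fun u hu => if_pos hu
      rw [e1, he, Finset.mul_sum]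
      congr 1
      refine Finset.sum_congr rfl fun u hu => ?_
      rw [Finset.mul_sum]
      refine Finset.sum_congr rfl fun v hv => ?_
      rw [if_pos hu, if_pos hv, ← hb2]
      ring
  obtain ⟨x, hx1, hx2⟩ := key a ha2
  obtain ⟨y, hy1, hy2⟩ := key (-a) (by rw [neg_sq, ha2])
  have h1 := le_sSup_spectrum (adj_isHermitian (joinOn G L)) x
  have h2 := sInf_spectrum_le (adj_isHermitian (joinOn G L)) y
  rw [hx1, hx2] at h1
  rw [hy1, hy2] at h2
  have hkm : 0 < 2 * (k * m) := by positivity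
  have e1 : e / (2 * k) * (2 * (k * m)) = m * e := by field_simp
  rw [Real.sqrt_mul hk0.le, ← ha, ← hb]
  constructor
  · refine le_of_mul_le_mul_right ?_ hkm
    rw [add_mul, e1]
    linarith
  · refine le_of_mul_le_mul_right ?_ hkm
    rw [sub_mul, e1]
    linarith

/-- The edges inside L shift both bounds of `joinOn_extreme_bounds` by the same amount, which
cancels. -/
theorem le_spread_joinOn (G : SimpleGraph V) (L : Finset V) (hL : 0 < L.card)
    (hL' : 0 < Lᶜ.card) :
    2 * √((L.card : ℝ) * (Lᶜ.card : ℝ)) ≤ spread (joinOn G L) := by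
  obtain ⟨h1, h2⟩ := joinOn_extreme_bounds G L hL hL'
  rw [spread]
  linarith

end Spectral

/-! ### Quadratic forms of sparse graphs and stability of Cauchy–Schwarz -/

section Dominating

open Classical

theorem cast_card_filter_adj {V : Type*} (G : SimpleGraph V) (S : Finset V) (v : V) :
    ((S.filter (G.Adj v)).card : ℝ) = ∑ w ∈ S, adj G v w := by
  simp only [adj_apply]
  rw [Finset.sum_boole]

theorem cast_pairs {V : Type*} (G : SimpleGraph V) (S : Finset V) :
    (pairs G S : ℝ) = ∑ u ∈ S, ∑ v ∈ S, adj G u v := by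
  rw [pairs, Nat.cast_sum]
  exact Finset.sum_congr rfl fun v _ => cast_card_filter_adj G S v

theorem sum_adj_mul {V : Type*} (G : SimpleGraph V) (S : Finset V) (v : V) (x : V → ℝ) :
    ∑ w ∈ S, adj G v w * x w = ∑ w ∈ S.filter (G.Adj v), x w := by
  rw [Finset.sum_filter]
  exact Finset.sum_congr rfl fun w _ => by rw [adj_apply]; split_ifs <;> simp

/-- In a degenerate graph, the quadratic form of the adjacency matrix is controlled by the
degeneracy and the degrees. -/
theorem sum_adj_le_of_degenerate {V : Type*} (G : SimpleGraph V) (c : ℕ)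
    (hG : ∀ S : Finset V, S.Nonempty → pairs G S < c * S.card) (x : V → ℝ) {t : ℝ} (ht : 0 < t)
    (S : Finset V) :
    ∑ u ∈ S, ∑ v ∈ S, adj G u v * (x u * x v) ≤
      c * t * ∑ u ∈ S, x u ^ 2 + 1 / t * ∑ u ∈ S, (∑ w ∈ S, adj G u w) * x u ^ 2 := by
  induction h : S.card generalizing S with
  | zero =>
    rw [Finset.card_eq_zero] at h
    simp [h]
  | succ n ih =>
    have hne : S.Nonempty := Finset.card_pos.mp (by omega)
    -- The average degree in S is below c, so a vertex of degree below c can be peeled off.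
    obtain ⟨v, hv, hdeg⟩ : ∃ v ∈ S, (S.filter (G.Adj v)).card < c := by
      by_contra hcon
      push Not at hcon
      have := Finset.card_nsmul_le_sum S _ c hcon
      have h' := hG S hne
      rw [pairs] at h'
      rw [smul_eq_mul, mul_comm] at this
      omega
    set S' := S.erase v with hS'
    have hvS' : v ∉ S' := by simp [hS']
    have hS : S = insert v S' := (Finset.insert_erase hv).symm
    have hvv : adj G v v = 0 := adj_of_not_adj (G.loopless.irrefl v)
    have hdeg' : ∑ w ∈ S', adj G v w ≤ c := by
      have : ∑ w ∈ S, adj G v w ≤ c := by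
        rw [← cast_card_filter_adj]
        exact_mod_cast hdeg.le
      rwa [hS, Finset.sum_insert hvS', hvv, zero_add] at this
    have ih' := ih S' (by rw [hS', Finset.card_erase_of_mem hv, h]; rfl)
    have e1 : ∑ a ∈ S, ∑ b ∈ S, adj G a b * (x a * x b) =
        ∑ a ∈ S', ∑ b ∈ S', adj G a b * (x a * x b) +
          ∑ b ∈ S', adj G v b * (2 * (x v * x b)) := by
      rw [hS]
      simp only [Finset.sum_insert hvS', hvv, Finset.sum_add_distrib]
      have : ∑ a ∈ S', adj G a v * (x a * x v) = ∑ b ∈ S', adj G v b * (x v * x b) :=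
        Finset.sum_congr rfl fun b _ => by rw [adj_symm, mul_comm (x b)]
      rw [this]
      have : ∑ b ∈ S', adj G v b * (2 * (x v * x b)) =
          2 * ∑ b ∈ S', adj G v b * (x v * x b) := by
        rw [Finset.mul_sum]
        exact Finset.sum_congr rfl fun b _ => by ring
      rw [this]
      ring
    have e2 : ∑ a ∈ S, (∑ w ∈ S, adj G a w) * x a ^ 2 =
        ∑ a ∈ S', (∑ w ∈ S', adj G a w) * x a ^ 2 + (∑ w ∈ S', adj G v w) * x v ^ 2 +
          ∑ b ∈ S', adj G v b * x b ^ 2 := by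
      rw [hS]
      simp only [Finset.sum_insert hvS', hvv, add_mul, Finset.sum_add_distrib]
      have : ∑ a ∈ S', adj G a v * x a ^ 2 = ∑ b ∈ S', adj G v b * x b ^ 2 :=
        Finset.sum_congr rfl fun b _ => by rw [adj_symm]
      rw [this]
      ring
    -- Weighted AM–GM. The term t·x_v² is paid at most c times, all when v is removed; the term
    -- x_b²/t is paid at most once per edge at b.
    have e3 : ∑ b ∈ S', adj G v b * (2 * (x v * x b)) ≤
        t * x v ^ 2 * ∑ b ∈ S', adj G v b + 1 / t * ∑ b ∈ S', adj G v b * x b ^ 2 := by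
      rw [Finset.mul_sum, Finset.mul_sum, ← Finset.sum_add_distrib]
      refine Finset.sum_le_sum fun b _ => ?_
      have h1 : 2 * (x v * x b) ≤ t * x v ^ 2 + 1 / t * x b ^ 2 := by
        have h2 : t * x v ^ 2 + 1 / t * x b ^ 2 - 2 * (x v * x b) = 1 / t * (t * x v - x b) ^ 2 := by
          field_simp
          ring
        have : 0 ≤ 1 / t * (t * x v - x b) ^ 2 := by positivity
        linarith
      have := mul_le_mul_of_nonneg_left h1 (adj_nonneg G v b)
      linarith
    have e4 : t * x v ^ 2 * ∑ b ∈ S', adj G v b ≤ t * x v ^ 2 * c :=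
      mul_le_mul_of_nonneg_left hdeg' (by positivity)
    have e5 : 0 ≤ 1 / t * ((∑ w ∈ S', adj G v w) * x v ^ 2) :=
      mul_nonneg (by positivity)
        (mul_nonneg (Finset.sum_nonneg fun w _ => adj_nonneg G v w) (sq_nonneg _))
    have e6 : ∑ u ∈ S, x u ^ 2 = x v ^ 2 + ∑ u ∈ S', x u ^ 2 := by
      rw [hS, Finset.sum_insert hvS']
    rw [e1, e2, e6]
    nlinarith [ih', e3, e4, e5]

/-- Few vertices have more than `k` neighbours in a given set. -/
theorem card_many_nbrs_le {V : Type*} [Fintype V] [DecidableEq V] {k r : ℕ} (hr : k + 2 = r) {G : SimpleGraph V}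
    (hG : CompleteMinorFree r G) (H : Finset V) :
    (Hᶜ.filter fun v => k + 1 ≤ (H.filter (G.Adj v)).card).card ≤ (k + 1) * 2 ^ H.card := by
  set B := Hᶜ.filter fun v => k + 1 ≤ (H.filter (G.Adj v)).card with hB
  -- Vertices are grouped by their trace on H. More than k + 1 vertices with a common trace of size
  -- at least k + 1 would give a K_{k+1,k+1}; contracting k edges of a perfect matching turns it
  -- into a graph containing K_{k+2}.
  have h1 : B.card ≤ (k + 1) * (B.image fun v => H.filter (G.Adj v)).card := by
    apply Finset.card_le_mul_card_image
    intro S hS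
    rw [Finset.mem_image] at hS
    obtain ⟨v, hv, rfl⟩ := hS
    set S := H.filter (G.Adj v) with hS
    by_contra hcon
    push Not at hcon
    set F := B.filter (fun w => H.filter (G.Adj w) = S) with hF
    have hSc : k + 1 ≤ S.card := by
      rw [hB, Finset.mem_filter] at hv
      exact hv.2
    have hFadj : ∀ w ∈ F, ∀ u ∈ S, G.Adj w u := by
      intro w hw u hu
      rw [hF, Finset.mem_filter] at hw
      rw [← hw.2, Finset.mem_filter] at hu
      exact hu.2
    obtain ⟨l⟩ : Nonempty (Fin (k + 1) ↪ S) :=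
      Function.Embedding.nonempty_of_card_le (by simpa using hSc)
    obtain ⟨t⟩ : Nonempty (Fin (k + 1) ↪ F) :=
      Function.Embedding.nonempty_of_card_le (by simpa using hcon.le)
    have hlt : ∀ i j, G.Adj (l i) (t j) := fun i j => (hFadj _ (t j).2 _ (l i).2).symm
    have hne : ∀ i j, (l i : V) ≠ t j := fun i j => (hlt i j).ne
    have hl : ∀ i j, i ≠ j → (l i : V) ≠ l j := fun i j h h' => h (l.injective (Subtype.ext h'))
    have ht : ∀ i j, i ≠ j → (t i : V) ≠ t j := fun i j h h' => h (t.injective (Subtype.ext h'))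
    have hlast : ∀ i : Fin k, Fin.last k ≠ i.castSucc := fun i => (Fin.castSucc_lt_last i).ne'
    refine hG (isMinor_of_biclique hr (fun i => (l i.castSucc : V)) (fun i => (t i.castSucc : V))
      (l (Fin.last k)) (t (Fin.last k)) (t (Fin.last k)) ?_ ?_ (fun i j => hlt _ _)
      (fun i => Or.inr (hlt _ _)) (fun i => Or.inl (hlt _ _).symm) (Or.inl rfl) (hlt _ _)
      (hne _ _) (fun i => hl _ _ (hlast i)) (fun i => hne _ _) (fun i => (hne _ _).symm)
      (fun i => ht _ _ (hlast i)) (fun i => (hne _ _).symm) (fun i => ht _ _ (hlast i)))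
    · intro i j hij
      by_contra h
      exact hl _ _ (fun h' => h (Fin.castSucc_injective k h')) hij
    · intro i j hij
      by_contra h
      exact ht _ _ (fun h' => h (Fin.castSucc_injective k h')) hij
  refine h1.trans (Nat.mul_le_mul_left _ ?_)
  rw [← Finset.card_powerset]
  apply Finset.card_le_card
  intro S hS
  rw [Finset.mem_image] at hS
  obtain ⟨v, -, rfl⟩ := hS
  exact Finset.mem_powerset.mpr (Finset.filter_subset _ _)

/-- A graph of large spread has a nonnegative unit vector with large quadratic form. -/
theorem exists_nonneg_quadForm_ge {V : Type*} [Fintype V] [DecidableEq V] [Nonempty V]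
    (G : SimpleGraph V) {g : ℝ} (hg : 2 * g ≤ spread G) :
    ∃ x : V → ℝ, (∀ v, 0 ≤ x v) ∧ ∑ v, x v ^ 2 = 1 ∧
      g ≤ ∑ u, ∑ v, adj G u v * (x u * x v) := by
  have hA := adj_isHermitian G
  have main : ∀ (y : V → ℝ) (θ : ℝ), y ≠ 0 → adj G *ᵥ y = θ • y → g ≤ |θ| →
      ∃ x : V → ℝ, (∀ v, 0 ≤ x v) ∧ ∑ v, x v ^ 2 = 1 ∧
      g ≤ ∑ u, ∑ v, adj G u v * (x u * x v) := by
    intro y θ hy hθ hgθ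
    have hpos := dotProduct_self_pos hy
    set c := √(y ⬝ᵥ y) with hc
    have hc0 : 0 < c := Real.sqrt_pos.mpr hpos
    have hc2 : c ^ 2 = y ⬝ᵥ y := Real.sq_sqrt hpos.le
    refine ⟨fun v => |y v| / c, fun v => by positivity, ?_, ?_⟩
    · simp only [div_pow, sq_abs]
      rw [← Finset.sum_div, hc2, dotProduct, div_eq_one_iff_eq (by rw [← dotProduct]; exact hpos.ne')]
      exact Finset.sum_congr rfl fun v _ => by ring
    · have h1 : y ⬝ᵥ adj G *ᵥ y = θ * c ^ 2 := by
        rw [hθ, dotProduct_smul, hc2, smul_eq_mul]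
      have h2 : |θ| * c ^ 2 ≤ ∑ u, ∑ v, adj G u v * (|y u| * |y v|) := by
        rw [← abs_of_pos (pow_pos hc0 2), ← abs_mul, ← h1, quadForm_adj]
        refine (Finset.abs_sum_le_sum_abs _ _).trans (Finset.sum_le_sum fun u _ => ?_)
        refine (Finset.abs_sum_le_sum_abs _ _).trans (Finset.sum_le_sum fun v _ => ?_)
        rw [abs_mul, abs_mul, abs_of_nonneg (adj_nonneg G u v)]
      have h3 : ∑ u, ∑ v, adj G u v * (|y u| / c * (|y v| / c)) =
          (∑ u, ∑ v, adj G u v * (|y u| * |y v|)) / c ^ 2 := by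
        simp only [Finset.sum_div]
        refine Finset.sum_congr rfl fun u _ => Finset.sum_congr rfl fun v _ => ?_
        field_simp
      rw [h3]
      refine hgθ.trans ?_
      rw [le_div_iff₀ (by positivity)]
      exact h2
  rw [spread] at hg
  -- Some extreme eigenvalue has modulus at least g; taking absolute values in its eigenvector can
  -- only increase the modulus of the form.
  rcases le_or_gt g (sSup (spectrum ℝ (adj G))) with h | h
  · obtain ⟨y, hy, hy'⟩ := exists_eigenvector_sSup hA
    exact main y _ hy hy' (h.trans (le_abs_self _))
  · obtain ⟨y, hy, hy'⟩ := exists_eigenvector_sInf hA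
    exact main y _ hy hy' (le_trans (by linarith) (neg_le_abs _))

/-- If the sum over a `k`-element set nearly attains the Cauchy-Schwarz bound, then the sum over
any other set of at most `k` elements stays away from it. -/
theorem card_eq_and_sq_sum_le {V : Type*} {k : ℕ} (hk : 1 ≤ k) {H S₀ : Finset V}
    {x : V → ℝ} (hx : ∀ v, 0 ≤ x v) {h : ℝ} (hh : h = ∑ v ∈ H, x v ^ 2) (hS₀ : S₀ ⊆ H)
    (hc₀ : S₀.card ≤ k) (hbig : ((k : ℝ) - 1 / 2) * h < (∑ v ∈ S₀, x v) ^ 2) :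
    0 < h ∧ S₀.card = k ∧ ∀ S ⊆ H, S.card ≤ k → S ≠ S₀ →
      (∑ v ∈ S, x v) ^ 2 ≤ (k - 1 / (64 * k)) * h := by
  have hk' : (1 : ℝ) ≤ k := by exact_mod_cast hk
  have hh0 : 0 ≤ h := hh ▸ Finset.sum_nonneg fun v _ => sq_nonneg _
  have hsub : ∀ S ⊆ H, ∑ v ∈ S, x v ^ 2 ≤ h := fun S hS =>
    hh ▸ Finset.sum_le_sum_of_subset_of_nonneg hS fun v _ _ => sq_nonneg _
  have hCS : ∀ (S : Finset V) (q : ℝ), (S.card : ℝ) ≤ q →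
      (∑ v ∈ S, x v) ^ 2 ≤ q * ∑ v ∈ S, x v ^ 2 := fun S q hq =>
    sq_sum_le_card_mul_sum_sq.trans
      (mul_le_mul_of_nonneg_right hq (Finset.sum_nonneg fun v _ => sq_nonneg _))
  have hpos : 0 < h := by
    rcases hh0.lt_or_eq with h0 | h0
    · exact h0
    · have h1 := hCS S₀ k (by exact_mod_cast hc₀)
      have h2 := hsub S₀ hS₀
      rw [← h0] at h2 hbig
      nlinarith
  have hlow : ∀ S ⊆ H, S.card < k → (∑ v ∈ S, x v) ^ 2 ≤ (k - 1) * h := by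
    intro S hS hc
    have h1 : (S.card : ℝ) + 1 ≤ k := by exact_mod_cast hc
    exact (hCS S (k - 1) (by linarith)).trans
      (mul_le_mul_of_nonneg_left (hsub S hS) (by linarith))
  have hcard : S₀.card = k := by
    by_contra hne
    have := hlow S₀ hS₀ (lt_of_le_of_ne hc₀ hne)
    nlinarith
  have h64 : 1 / (64 * (k : ℝ)) ≤ 1 := by
    rw [div_le_one (by positivity)]
    linarith
  refine ⟨hpos, hcard, fun S hS hc hne => ?_⟩
  rcases hc.lt_or_eq with hlt | heq
  · exact (hlow S hS hlt).trans (mul_le_mul_of_nonneg_right (by linarith) hh0)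
  obtain ⟨u, hu, huS⟩ : ∃ u ∈ S₀, u ∉ S := by
    by_contra hcon
    push Not at hcon
    exact hne (Finset.eq_of_subset_of_card_le hcon (by omega)).symm
  set a := ∑ v ∈ S₀.erase u, x v with ha
  have ha0 : 0 ≤ a := Finset.sum_nonneg fun v _ => hx v
  have hsum : ∑ v ∈ S₀, x v = x u + a := (Finset.add_sum_erase _ _ hu).symm
  have ha2 : a ^ 2 ≤ (k - 1) * h :=
    hlow _ ((Finset.erase_subset _ _).trans hS₀) (by rw [Finset.card_erase_of_mem hu]; omega)
  -- Otherwise x_u² is at most h/64, the other k - 1 entries of S₀ contribute at most (k-1)h, and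
  -- the cross term is at most h/4. The total stays below (k - 1/2)h.
  have hxu : h / (64 * k ^ 2) ≤ x u ^ 2 := by
    by_contra hcon
    push Not at hcon
    rw [lt_div_iff₀ (by positivity)] at hcon
    have h1 : x u ^ 2 ≤ h / 64 := by nlinarith [sq_nonneg (x u)]
    have h2 : 2 * (x u * a) ≤ h / 4 := by
      apply abs_le_of_sq_le_sq' _ (by positivity) |>.2
      have h3 : x u ^ 2 * a ^ 2 ≤ x u ^ 2 * (k * h) :=
        mul_le_mul_of_nonneg_left (by nlinarith) (sq_nonneg _)
      have h4 : x u ^ 2 * k ≤ h / 64 := by nlinarith [sq_nonneg (x u)]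
      nlinarith
    rw [hsum] at hbig
    nlinarith
  have hins : x u ^ 2 + ∑ v ∈ S, x v ^ 2 ≤ h := by
    rw [← Finset.sum_insert (f := fun v => x v ^ 2) huS]
    exact hsub _ (Finset.insert_subset (hS₀ hu) hS)
  -- S misses u and therefore forgoes its mass in Cauchy–Schwarz.
  calc (∑ v ∈ S, x v) ^ 2 ≤ k * ∑ v ∈ S, x v ^ 2 := hCS S k (by exact_mod_cast hc)
    _ ≤ k * (h - h / (64 * k ^ 2)) := mul_le_mul_of_nonneg_left (by linarith) (by linarith)
    _ = (k - 1 / (64 * k)) * h := by field_simp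

end Dominating

/-! ### A k-set adjacent to almost all vertices -/

section DominatingSet

open Classical

/-- Isolates the one term that can be of order √n with a large constant. With H the heavy vertices
and B the exceptional light ones, the first two terms are bounded, and t of order √n makes the
light–light term a small multiple of √n. -/
theorem sum_adj_le_heavy_light {V : Type*} [Fintype V] [DecidableEq V] (G : SimpleGraph V) (c : ℕ)
    (hG : ∀ S : Finset V, S.Nonempty → pairs G S < c * S.card) {x : V → ℝ} (hx : ∀ v, 0 ≤ x v)
    (hx1 : ∑ v, x v ^ 2 = 1) {H B : Finset V} (hB : B ⊆ Hᶜ) {t D : ℝ} (ht : 0 < t)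
    (hD0 : 0 ≤ D) (hD : ∀ v ∉ H, ∑ w, adj G v w ≤ D) :
    ∑ u, ∑ v, adj G u v * (x u * x v) ≤ (H.card : ℝ) ^ 2 + 2 * (B.card * H.card) +
      (c * t + D / t) + 2 * ∑ v ∈ Hᶜ \ B, x v * ∑ u ∈ H, adj G v u * x u := by
  have hxle : ∀ v, x v ≤ 1 := fun v => by
    have : x v ^ 2 ≤ 1 := hx1 ▸ Finset.single_le_sum (f := fun v => x v ^ 2)
      (fun i _ => sq_nonneg _) (Finset.mem_univ v)
    nlinarith [hx v]
  have hprod : ∀ u v, adj G u v * (x u * x v) ≤ 1 := fun u v =>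
    mul_le_one₀ (adj_le_one G u v) (mul_nonneg (hx u) (hx v))
      (mul_le_one₀ (hxle u) (hx v) (hxle v))
  have hsumle : ∀ S : Finset V, ∑ v ∈ S, x v ^ 2 ≤ 1 := fun S =>
    hx1 ▸ Finset.sum_le_sum_of_subset_of_nonneg (Finset.subset_univ S) fun v _ _ => sq_nonneg _
  rw [sum_sum_split H]
  have h1 : ∑ u ∈ H, ∑ v ∈ H, adj G u v * (x u * x v) ≤ (H.card : ℝ) ^ 2 := by
    calc _ ≤ ∑ u ∈ H, ∑ v ∈ H, (1 : ℝ) :=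
          Finset.sum_le_sum fun u _ => Finset.sum_le_sum fun v _ => hprod u v
      _ = _ := by simp [sq]
  have hswap : ∑ u ∈ H, ∑ v ∈ Hᶜ, adj G u v * (x u * x v) =
      ∑ v ∈ Hᶜ, x v * ∑ u ∈ H, adj G v u * x u := by
    rw [Finset.sum_comm]
    refine Finset.sum_congr rfl fun v _ => ?_
    rw [Finset.mul_sum]
    exact Finset.sum_congr rfl fun u _ => by rw [adj_symm]; ring
  have hswap' : ∑ u ∈ Hᶜ, ∑ v ∈ H, adj G u v * (x u * x v) =
      ∑ v ∈ Hᶜ, x v * ∑ u ∈ H, adj G v u * x u := by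
    refine Finset.sum_congr rfl fun v _ => ?_
    rw [Finset.mul_sum]
    exact Finset.sum_congr rfl fun u _ => by ring
  have h2 : ∑ v ∈ Hᶜ, x v * ∑ u ∈ H, adj G v u * x u ≤
      B.card * H.card + ∑ v ∈ Hᶜ \ B, x v * ∑ u ∈ H, adj G v u * x u := by
    rw [← Finset.sum_sdiff hB, add_comm]
    gcongr
    calc ∑ v ∈ B, x v * ∑ u ∈ H, adj G v u * x u ≤ ∑ v ∈ B, ∑ u ∈ H, (1 : ℝ) := by
          refine Finset.sum_le_sum fun v _ => ?_
          rw [Finset.mul_sum]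
          refine Finset.sum_le_sum fun u _ => ?_
          have := hprod v u
          linarith
      _ = _ := by simp
  have h3 : ∑ u ∈ Hᶜ, ∑ v ∈ Hᶜ, adj G u v * (x u * x v) ≤ c * t + D / t := by
    refine (sum_adj_le_of_degenerate G c hG x ht Hᶜ).trans ?_
    have e1 : (c : ℝ) * t * ∑ u ∈ Hᶜ, x u ^ 2 ≤ c * t * 1 :=
      mul_le_mul_of_nonneg_left (hsumle _) (by positivity)
    have e2 : ∑ u ∈ Hᶜ, (∑ w ∈ Hᶜ, adj G u w) * x u ^ 2 ≤ ∑ u ∈ Hᶜ, D * x u ^ 2 := by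
      refine Finset.sum_le_sum fun u hu => mul_le_mul_of_nonneg_right ?_ (sq_nonneg _)
      refine le_trans ?_ (hD u (Finset.mem_compl.mp hu))
      exact Finset.sum_le_sum_of_subset_of_nonneg (Finset.subset_univ _)
        fun w _ _ => adj_nonneg G u w
    have e3 : ∑ u ∈ Hᶜ, D * x u ^ 2 ≤ D := by
      rw [← Finset.mul_sum]
      nlinarith [hsumle Hᶜ]
    have e4 : 1 / t * ∑ u ∈ Hᶜ, (∑ w ∈ Hᶜ, adj G u w) * x u ^ 2 ≤ 1 / t * D :=
      mul_le_mul_of_nonneg_left (e2.trans e3) (by positivity)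
    rw [mul_one] at e1
    rw [one_div_mul_eq_div t D] at e4
    exact add_le_add e1 e4
  rw [hswap, hswap']
  linarith

/-- Three losses of at most (e/8)√(kn) leave 2Z ≥ (1 - 3e/8)√(kn). Were the conclusion false, h(1-h)
≤ 1/4 would give 4Z² ≤ (1-e)kn, which is less than (1 - 3e/8)²kn. -/
theorem mul_lt_of_sqrt_le {k n e K Z h Q : ℝ} (hk : 1 ≤ k) (hn : 1 ≤ n) (he0 : 0 < e)
    (he3 : e ≤ 1 / 2) (hK : K ≤ e / 8 * √n) (hkn : 8 * k ≤ n * e)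
    (hZ : √(k * (n - k)) ≤ K + e / 8 * √n + 2 * Z) (hZQ : Z ^ 2 ≤ (1 - h) * Q)
    (hh1 : h ≤ 1) : (1 - e) * k * n * h < Q := by
  set q := √(k * n) with hq
  have hq2 : q ^ 2 = k * n := Real.sq_sqrt (by positivity)
  have hq0 : 0 ≤ q := Real.sqrt_nonneg _
  have hsq : √n ≤ q := Real.sqrt_le_sqrt (by nlinarith)
  have e6 : (0 : ℝ) < k * n := by positivity
  have hgq : (1 - e / 8) * q ≤ √(k * (n - k)) := by
    apply Real.le_sqrt_of_sq_le
    rw [mul_pow, hq2]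
    have h1 : (1 - e / 8) * (k * n) ≤ k * (n - k) := by nlinarith
    have h2 : (1 - e / 8) ^ 2 ≤ 1 - e / 8 := by nlinarith
    nlinarith
  have hZlow : (1 - 3 * e / 8) * q ≤ 2 * Z := by nlinarith
  by_contra hcon
  push Not at hcon
  have e1 : 4 * Z ^ 2 ≤ (1 - e) * (k * n) := by
    have e2 : (1 - h) * Q ≤ (1 - h) * ((1 - e) * k * n * h) :=
      mul_le_mul_of_nonneg_left hcon (by linarith)
    have e3 : (1 - h) * h ≤ 1 / 4 := by nlinarith [sq_nonneg (h - 1 / 2)]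
    have e4 : 0 ≤ (1 - e) * (k * n) := mul_nonneg (by linarith) e6.le
    nlinarith
  have e5 : ((1 - 3 * e / 8) * q) ^ 2 ≤ (2 * Z) ^ 2 :=
    pow_le_pow_left₀ (mul_nonneg (by linarith) hq0) hZlow 2
  rw [mul_pow, hq2] at e5
  have e7 : 1 - e < (1 - 3 * e / 8) ^ 2 := by nlinarith
  nlinarith

/-- If the average of `(∑ u ∈ H ∩ N(v), x u) ^ 2` over `v ∈ W` is nearly maximal, then most
neighbourhoods in `H` are one and the same `k`-set. -/
theorem exists_common_neighborhood {V : Type*} [DecidableEq V] (G : SimpleGraph V) {k : ℕ} (hk : 1 ≤ k)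
    {H W : Finset V} {x : V → ℝ} (hx : ∀ v, 0 ≤ x v) {e n : ℝ} (he : e * k ≤ 1 / 2)
    (hW : (W.card : ℝ) ≤ n) (hgood : ∀ v ∈ W, (H.filter (G.Adj v)).card ≤ k)
    (hQ : (1 - e) * k * n * ∑ v ∈ H, x v ^ 2 <
      ∑ v ∈ W, (∑ u ∈ H.filter (G.Adj v), x u) ^ 2) :
    ∃ S₀ : Finset V, S₀.card = k ∧
      ((W.filter fun v => H.filter (G.Adj v) ≠ S₀).card : ℝ) ≤ 64 * k ^ 2 * e * n := by
  have hkR : (1 : ℝ) ≤ k := by exact_mod_cast hk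
  have hn0 : 0 ≤ n := le_trans (Nat.cast_nonneg _) hW
  obtain ⟨h, hh⟩ : ∃ h, h = ∑ v ∈ H, x v ^ 2 := ⟨_, rfl⟩
  have hh0 : 0 ≤ h := hh ▸ Finset.sum_nonneg fun v _ => sq_nonneg _
  rw [← hh] at hQ
  have he1 : 0 ≤ 1 - e := by nlinarith
  -- By averaging some trace is almost optimal, and e·k ≤ 1/2 puts it in the range of
  -- `card_eq_and_sq_sum_le`. This trace is S₀.
  obtain ⟨v₀, hv₀, hv₀'⟩ : ∃ v ∈ W,
      (1 - e) * k * h < (∑ u ∈ H.filter (G.Adj v), x u) ^ 2 := by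
    by_contra hcon
    push Not at hcon
    have e1 := Finset.sum_le_card_nsmul _ _ _ hcon
    rw [nsmul_eq_mul] at e1
    have e2 : 0 ≤ (1 - e) * k * h := by positivity
    have := mul_le_mul_of_nonneg_right hW e2
    linarith
  have hbig : ((k : ℝ) - 1 / 2) * h < (∑ v ∈ H.filter (G.Adj v₀), x v) ^ 2 := by
    refine lt_of_le_of_lt ?_ hv₀'
    nlinarith
  obtain ⟨hpos, hSk, hother⟩ := card_eq_and_sq_sum_le hk hx hh (Finset.filter_subset _ _)
    (hgood v₀ hv₀) hbig
  refine ⟨_, hSk, ?_⟩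
  generalize H.filter (G.Adj v₀) = S₀ at *
  obtain ⟨F, hF⟩ : ∃ F, F = W.filter fun v => H.filter (G.Adj v) ≠ S₀ := ⟨_, rfl⟩
  -- Each vertex with another trace loses h/(64k) against the maximum kh, while the total loss
  -- allowed is below e·k·n·h.
  have e1 : ∑ v ∈ W, (∑ u ∈ H.filter (G.Adj v), x u) ^ 2 ≤
      W.card * (k * h) - 1 / (64 * k) * h * F.card := by
    calc _ ≤ ∑ v ∈ W,
          (k * h - if H.filter (G.Adj v) ≠ S₀ then 1 / (64 * k) * h else 0) := by
          refine Finset.sum_le_sum fun v hv => ?_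
          split_ifs with hne
          · have := hother _ (Finset.filter_subset _ _) (hgood v hv) hne
            linarith
          · rw [sub_zero]
            refine sq_sum_le_card_mul_sum_sq.trans ?_
            refine mul_le_mul (by exact_mod_cast hgood v hv) ?_
              (Finset.sum_nonneg fun v _ => sq_nonneg _) (by linarith)
            rw [hh]
            exact Finset.sum_le_sum_of_subset_of_nonneg (Finset.filter_subset _ _)
              fun v _ _ => sq_nonneg _
      _ = _ := by
          rw [Finset.sum_sub_distrib, Finset.sum_const, nsmul_eq_mul, ← Finset.sum_filter,
            Finset.sum_const, nsmul_eq_mul, ← hF]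
          ring
  have e2 : (W.card : ℝ) * (k * h) ≤ n * (k * h) :=
    mul_le_mul_of_nonneg_right hW (by positivity)
  rw [← hF]
  have e3 : (1 / (64 * k) * F.card) * h < (e * k * n) * h := by linarith
  have e4 := lt_of_mul_lt_mul_right e3 hpos.le
  have e5 : (F.card : ℝ) = (64 * k) * (1 / (64 * k) * F.card) := by field_simp
  rw [e5]
  have e6 := mul_lt_mul_of_pos_left e4 (by positivity : (0 : ℝ) < 64 * k)
  linarith

/-- The degree sum is at most c times the number of vertices. The point is that the resulting bound
does not depend on that number. -/
theorem card_heavy_le {V : Type*} [Fintype V] [Nonempty V] (G : SimpleGraph V) (c : ℕ)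
    (hG : ∀ S : Finset V, S.Nonempty → pairs G S < c * S.card) {η : ℝ} (hη : 0 < η) :
    (Finset.univ.filter fun v => c * η ^ 2 * Fintype.card V < ∑ w, adj G v w).card ≤
      ⌈1 / η ^ 2⌉₊ := by
  obtain ⟨H, hH⟩ : ∃ H, H = Finset.univ.filter fun v =>
    c * η ^ 2 * Fintype.card V < ∑ w, adj G v w := ⟨_, rfl⟩
  rw [← hH]
  have hn : (0 : ℝ) < Fintype.card V := by exact_mod_cast Fintype.card_pos
  have hlt := hG Finset.univ Finset.univ_nonempty
  rw [Finset.card_univ] at hlt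
  have hc : (0 : ℝ) < c := by
    have : 0 < c := by
      by_contra h
      have : c = 0 := by omega
      simp [this] at hlt
    exact_mod_cast this
  have e1 : (H.card : ℝ) * (c * η ^ 2 * Fintype.card V) ≤ c * Fintype.card V := by
    calc (H.card : ℝ) * (c * η ^ 2 * Fintype.card V)
        = ∑ v ∈ H, c * η ^ 2 * (Fintype.card V : ℝ) := by rw [Finset.sum_const, nsmul_eq_mul]
      _ ≤ ∑ v ∈ H, ∑ w, adj G v w :=
        Finset.sum_le_sum fun v hv => by
          rw [hH] at hv
          exact (Finset.mem_filter.mp hv).2.le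
      _ ≤ ∑ v, ∑ w, adj G v w :=
        Finset.sum_le_sum_of_subset_of_nonneg (Finset.subset_univ _)
          fun v _ _ => Finset.sum_nonneg fun w _ => adj_nonneg G v w
      _ = (pairs G Finset.univ : ℝ) := (cast_pairs G _).symm
      _ ≤ c * Fintype.card V := by exact_mod_cast hlt.le
  have e2 : (H.card : ℝ) ≤ 1 / η ^ 2 := by
    rw [le_div_iff₀ (by positivity)]
    have h1 : (0 : ℝ) < c * Fintype.card V := by positivity
    have h2 : ((H.card : ℝ) * η ^ 2) * (c * Fintype.card V) ≤ 1 * (c * Fintype.card V) := by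
      linarith
    exact le_of_mul_le_mul_right h2 h1
  exact_mod_cast e2.trans (Nat.le_ceil _)

/-- A `K_{k+2}`-minor-free graph of large spread has `k` vertices adjacent to almost all others. -/
theorem exists_dominating_set {k r : ℕ} (hk : 1 ≤ k) (hr : k + 2 = r) {δ : ℝ} (hδ : 0 < δ) :
    ∃ N : ℕ, ∀ n ≥ N, ∀ G : SimpleGraph (Fin n), CompleteMinorFree r G →
      2 * √((k : ℝ) * (n - k)) ≤ spread G →
      ∃ L : Finset (Fin n), L.card = k ∧
        ((Finset.univ.filter fun v => v ∉ L ∧ ¬ ∀ u ∈ L, G.Adj v u).card : ℝ) ≤ δ * n := by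
  obtain ⟨c₀, hc₀⟩ := CompleteMinorFree.exists_pairs_lt r
  -- The shift by one makes c positive, as the definition of η requires.
  obtain ⟨c, hc⟩ : ∃ c : ℕ, c = c₀ + 1 := ⟨_, rfl⟩
  have hcpos : (0 : ℝ) < c := by rw [hc]; positivity
  have hkR : (1 : ℝ) ≤ k := by exact_mod_cast hk
  obtain ⟨e, he0, he1, he2⟩ : ∃ e : ℝ, 0 < e ∧ e * k ≤ 1 / 2 ∧ e * (128 * k ^ 2) ≤ δ := by
    refine ⟨min (1 / (2 * k)) (δ / (128 * k ^ 2)), lt_min (by positivity) (by positivity), ?_, ?_⟩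
    · have : min (1 / (2 * (k : ℝ))) (δ / (128 * k ^ 2)) ≤ 1 / (2 * k) := min_le_left _ _
      rw [le_div_iff₀ (by positivity)] at this
      linarith
    · rw [← le_div_iff₀ (by positivity)]
      exact min_le_right _ _
  have he3 : e ≤ 1 / 2 := by nlinarith
  -- With t = η√n and degree threshold D = cη²n, the light–light term is 2cη√n = (e/8)√n.
  obtain ⟨η, hη⟩ : ∃ η : ℝ, η = e / (16 * c) := ⟨_, rfl⟩
  have hη0 : 0 < η := by rw [hη]; positivity
  have hcη : c * η = e / 16 := by rw [hη]; field_simp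
  obtain ⟨h₁, hh₁⟩ : ∃ h₁ : ℕ, h₁ = ⌈1 / η ^ 2⌉₊ := ⟨_, rfl⟩
  obtain ⟨K₁, hK₁⟩ : ∃ K₁ : ℕ, K₁ = (k + 1) * 2 ^ h₁ := ⟨_, rfl⟩
  obtain ⟨K₀, hK₀⟩ : ∃ K₀ : ℝ, K₀ = (h₁ : ℝ) ^ 2 + 2 * (K₁ * h₁) := ⟨_, rfl⟩
  -- The thresholds give K₀ ≤ (e/8)√n, 8k ≤ en and h₁ + K₁ ≤ δn/2; the other δn/2 is for vertices
  -- with a wrong trace.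
  refine ⟨⌈(8 * K₀ / e) ^ 2⌉₊ + ⌈8 * k / e⌉₊ + ⌈2 * (h₁ + K₁) / δ⌉₊ + 1, fun n hn G hG hs => ?_⟩
  have hn1 : 1 ≤ n := by omega
  have hnR : (1 : ℝ) ≤ n := by exact_mod_cast hn1
  have b1 : (8 * K₀ / e) ^ 2 ≤ n := Nat.ceil_le.mp (by omega)
  have b2 : 8 * k / e ≤ (n : ℝ) := Nat.ceil_le.mp (by omega)
  have b3 : 2 * (h₁ + K₁) / δ ≤ (n : ℝ) := Nat.ceil_le.mp (by omega)
  have b1' : K₀ ≤ e / 8 * √n := by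
    have := Real.le_sqrt_of_sq_le b1
    rw [div_le_iff₀ he0] at this
    linarith
  rw [div_le_iff₀ he0] at b2
  rw [div_le_iff₀ hδ] at b3
  clear b1
  have : Nonempty (Fin n) := ⟨⟨0, hn1⟩⟩
  have hpairs : ∀ S : Finset (Fin n), S.Nonempty → pairs G S < c * S.card := fun S hS =>
    (hc₀ G hG S hS).trans_le (Nat.mul_le_mul_right _ (by omega))
  obtain ⟨x, hx, hx1, hxg⟩ := exists_nonneg_quadForm_ge G hs
  have hs0 : 0 < √(n : ℝ) := Real.sqrt_pos.mpr (by linarith)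
  have hs2 : √(n : ℝ) ^ 2 = n := Real.sq_sqrt (by linarith)
  obtain ⟨D, hD⟩ : ∃ D : ℝ, D = c * η ^ 2 * n := ⟨_, rfl⟩
  have hD0 : 0 ≤ D := by rw [hD]; positivity
  have hHcard := card_heavy_le G c hpairs hη0
  rw [Fintype.card_fin, ← hD, ← hh₁] at hHcard
  obtain ⟨H, hH⟩ : ∃ H : Finset (Fin n), H = Finset.univ.filter fun v => D < ∑ w, adj G v w :=
    ⟨_, rfl⟩
  rw [← hH] at hHcard
  have hHD : ∀ v ∉ H, ∑ w, adj G v w ≤ D := fun v hv => by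
    simpa only [hH, Finset.mem_filter, Finset.mem_univ, true_and, not_lt] using hv
  have hBcard := (card_many_nbrs_le hr hG H).trans
    (Nat.mul_le_mul_left _ (Nat.pow_le_pow_right (by norm_num) hHcard))
  rw [← hK₁] at hBcard
  obtain ⟨B, hB⟩ : ∃ B : Finset (Fin n), B = Hᶜ.filter fun v =>
    k + 1 ≤ (H.filter (G.Adj v)).card := ⟨_, rfl⟩
  rw [← hB] at hBcard
  have hmain := sum_adj_le_heavy_light G c hpairs hx hx1 (hB ▸ Finset.filter_subset _ _ : B ⊆ Hᶜ)
    (mul_pos hη0 hs0) hD0 hHD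
  have hsmall : (H.card : ℝ) ^ 2 + 2 * (B.card * H.card) ≤ K₀ := by
    rw [hK₀]
    gcongr
  have hRR : c * (η * √n) + D / (η * √n) = e / 8 * √n := by
    have : D / (η * √n) = c * η * √n := by
      rw [hD, div_eq_iff (mul_pos hη0 hs0).ne']
      nth_rewrite 1 [← hs2]
      ring
    rw [this, ← mul_assoc, hcη]
    ring
  have hZQ : (∑ v ∈ Hᶜ \ B, x v * ∑ u ∈ H, adj G v u * x u) ^ 2 ≤ (1 - ∑ v ∈ H, x v ^ 2) *
      ∑ v ∈ Hᶜ \ B, (∑ u ∈ H.filter (G.Adj v), x u) ^ 2 := by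
    rw [Finset.sum_congr rfl fun v _ => by rw [sum_adj_mul]]
    refine (Finset.sum_mul_sq_le_sq_mul_sq _ _ _).trans
      (mul_le_mul_of_nonneg_right ?_ (Finset.sum_nonneg fun v _ => sq_nonneg _))
    have e2 : ∑ v ∈ Hᶜ \ B, x v ^ 2 ≤ ∑ v ∈ Hᶜ, x v ^ 2 :=
      Finset.sum_le_sum_of_subset_of_nonneg Finset.sdiff_subset fun v _ _ => sq_nonneg _
    have e3 := Finset.sum_add_sum_compl H fun v => x v ^ 2
    rw [hx1] at e3
    linarith
  have hh1 : ∑ v ∈ H, x v ^ 2 ≤ 1 :=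
    hx1 ▸ Finset.sum_le_sum_of_subset_of_nonneg (Finset.subset_univ H) fun v _ _ => sq_nonneg _
  have hQ := mul_lt_of_sqrt_le hkR hnR he0 he3 b1' b2 (by linarith) hZQ hh1
  have hcardn : ((Hᶜ \ B).card : ℝ) ≤ n := by
    have := Finset.card_le_univ (Hᶜ \ B)
    rw [Fintype.card_fin] at this
    exact_mod_cast this
  have hgood : ∀ v ∈ Hᶜ \ B, (H.filter (G.Adj v)).card ≤ k := by
    intro v hv
    simp only [hB, Finset.mem_sdiff, Finset.mem_filter, not_and, not_le] at hv
    exact Nat.lt_succ_iff.mp (hv.2 hv.1)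
  obtain ⟨S₀, hSk, hF⟩ := exists_common_neighborhood G hk hx he1 hcardn hgood hQ
  refine ⟨S₀, hSk, ?_⟩
  obtain ⟨F, hFdef⟩ : ∃ F : Finset (Fin n), F =
    (Hᶜ \ B).filter fun v => H.filter (G.Adj v) ≠ S₀ := ⟨_, rfl⟩
  rw [← hFdef] at hF
  have hsub : (Finset.univ.filter fun v => v ∉ S₀ ∧ ¬ ∀ u ∈ S₀, G.Adj v u) ⊆ (H ∪ B) ∪ F := by
    intro v hv
    simp only [Finset.mem_filter, Finset.mem_univ, true_and] at hv
    by_cases hvH : v ∈ H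
    · exact Finset.mem_union_left _ (Finset.mem_union_left _ hvH)
    by_cases hvB : v ∈ B
    · exact Finset.mem_union_left _ (Finset.mem_union_right _ hvB)
    refine Finset.mem_union_right _ (hFdef ▸ Finset.mem_filter.mpr ⟨?_, ?_⟩)
    · exact Finset.mem_sdiff.mpr ⟨Finset.mem_compl.mpr hvH, hvB⟩
    · intro heq
      refine hv.2 fun u hu => ?_
      rw [← heq, Finset.mem_filter] at hu
      exact hu.2
  have hfin := (Finset.card_le_card hsub).trans ((Finset.card_union_le _ _).trans
    (Nat.add_le_add_right (Finset.card_union_le _ _) _))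
  have hfin' : ((Finset.univ.filter fun v => v ∉ S₀ ∧ ¬ ∀ u ∈ S₀, G.Adj v u).card : ℝ) ≤
      h₁ + K₁ + F.card := by
    have : (Finset.univ.filter fun v => v ∉ S₀ ∧ ¬ ∀ u ∈ S₀, G.Adj v u).card ≤
        h₁ + K₁ + F.card := by omega
    exact_mod_cast this
  have hFn : (F.card : ℝ) ≤ δ * n / 2 := by
    have := mul_le_mul_of_nonneg_right he2 (by linarith : (0 : ℝ) ≤ n)
    linarith
  linarith

end DominatingSet

/-! ### Perturbation by a sparse graph -/

section Perturbation

/-- The Frobenius bound for the restriction of the adjacency matrix to `R`. -/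
theorem sum_sq_adj_le {V : Type*} (G : SimpleGraph V) (R : Finset V) (z : V → ℝ) :
    ∑ v ∈ R, (∑ w ∈ R, adj G v w * z w) ^ 2 ≤
      (∑ v ∈ R, ∑ w ∈ R, adj G v w) * ∑ w ∈ R, z w ^ 2 := by
  rw [Finset.sum_mul]
  refine Finset.sum_le_sum fun v _ => (Finset.sum_mul_sq_le_sq_mul_sq _ _ _).trans ?_
  refine mul_le_mul_of_nonneg_right (Finset.sum_le_sum fun w _ => ?_)
    (Finset.sum_nonneg fun w _ => sq_nonneg _)
  have h0 := adj_nonneg G v w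
  have h1 := adj_le_one G v w
  nlinarith

theorem sum_mul_adj_comm {V : Type*} (G : SimpleGraph V) (R : Finset V) (y z : V → ℝ) :
    ∑ v ∈ R, y v * ∑ w ∈ R, adj G v w * z w = ∑ v ∈ R, (∑ w ∈ R, adj G v w * y w) * z v := by
  simp only [Finset.mul_sum, Finset.sum_mul]
  rw [Finset.sum_comm]
  refine Finset.sum_congr rfl fun v _ => Finset.sum_congr rfl fun w _ => ?_
  rw [adj_symm]
  ring

/-- If `θ x = b + A_R x` on a sparse set `R` and `θ` is large, then `A_R x` is small compared
with `b`. -/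
theorem sparse_perturbation {V : Type*} (G : SimpleGraph V) (R : Finset V) {x b : V → ℝ}
    {θ M Δ E : ℝ} (hθ : θ ≠ 0) (hx : ∀ v ∈ R, θ * x v = b v + ∑ w ∈ R, adj G v w * x w)
    (hM : 0 ≤ M) (hb : ∀ v ∈ R, b v ^ 2 ≤ M) (hΔ : ∀ v ∈ R, ∑ w ∈ R, adj G v w ≤ Δ)
    (hE : ∑ v ∈ R, ∑ w ∈ R, adj G v w ≤ E) (hEθ : 4 * E ≤ θ ^ 2) (hΔ0 : 0 ≤ Δ) :
    θ ^ 2 * ∑ v ∈ R, (∑ w ∈ R, adj G v w * x w) ^ 2 ≤ 4 * (M * Δ * E) ∧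
    |∑ v ∈ R, b v * ∑ w ∈ R, adj G v w * x w| ≤ M * E * (1 / |θ| + 2 * Δ / θ ^ 2) := by
  have hθ2 : 0 < θ ^ 2 := by positivity
  have hθa : 0 < |θ| := abs_pos.mpr hθ
  have hE0 : 0 ≤ E := (Finset.sum_nonneg fun v _ => Finset.sum_nonneg fun w _ =>
    adj_nonneg G v w).trans hE
  obtain ⟨y, hy⟩ : ∃ y : V → ℝ, y = fun v => ∑ w ∈ R, adj G v w * x w := ⟨_, rfl⟩
  obtain ⟨z, hz⟩ : ∃ z : V → ℝ, z = fun v => ∑ w ∈ R, adj G v w * b w := ⟨_, rfl⟩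
  have hyv : ∀ v, ∑ w ∈ R, adj G v w * x w = y v := fun v => by rw [hy]
  have hzv : ∀ v, ∑ w ∈ R, adj G v w * b w = z v := fun v => by rw [hz]
  simp only [hyv] at hx ⊢
  -- Applying A_R to the equation shows that y = A_R x solves the same equation with source z = A_R
  -- b.
  have hθy : ∀ v, θ * y v = z v + ∑ w ∈ R, adj G v w * y w := by
    intro v
    rw [← hyv v, ← hzv v, Finset.mul_sum, ← Finset.sum_add_distrib]
    refine Finset.sum_congr rfl fun w hw => ?_
    rw [← mul_add, ← hx w hw]
    ring
  have habs : ∀ v ∈ R, |b v| ≤ √M := fun v hv => Real.abs_le_sqrt (hb v hv)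
  have hz2 : ∀ v ∈ R, z v ^ 2 ≤ M * Δ * ∑ w ∈ R, adj G v w := by
    intro v hv
    have h0 : 0 ≤ ∑ w ∈ R, adj G v w := Finset.sum_nonneg fun w _ => adj_nonneg G v w
    have h1 : |z v| ≤ (∑ w ∈ R, adj G v w) * √M := by
      rw [← hzv v, Finset.sum_mul]
      refine (Finset.abs_sum_le_sum_abs _ _).trans (Finset.sum_le_sum fun w hw => ?_)
      rw [abs_mul, abs_of_nonneg (adj_nonneg G v w)]
      exact mul_le_mul_of_nonneg_left (habs w hw) (adj_nonneg G v w)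
    have h2 : z v ^ 2 ≤ ((∑ w ∈ R, adj G v w) * √M) ^ 2 := by
      rw [← sq_abs]
      exact pow_le_pow_left₀ (abs_nonneg _) h1 2
    rw [mul_pow, Real.sq_sqrt hM] at h2
    have h3 := mul_le_mul_of_nonneg_right (hΔ v hv) (mul_nonneg h0 hM)
    linarith
  have hN2 : ∑ v ∈ R, z v ^ 2 ≤ M * Δ * E := by
    refine (Finset.sum_le_sum hz2).trans ?_
    rw [← Finset.mul_sum]
    exact mul_le_mul_of_nonneg_left hE (mul_nonneg hM hΔ0)
  have hN1 : θ ^ 2 * ∑ v ∈ R, y v ^ 2 ≤ 4 * (M * Δ * E) := by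
    -- By the Frobenius bound ‖A_R y‖² ≤ E‖y‖² ≤ (θ²/4)‖y‖², so this term is absorbed on the left.
    have h1 : θ ^ 2 * ∑ v ∈ R, y v ^ 2 ≤
        2 * ∑ v ∈ R, z v ^ 2 + 2 * ∑ v ∈ R, (∑ w ∈ R, adj G v w * y w) ^ 2 := by
      rw [Finset.mul_sum, Finset.mul_sum, Finset.mul_sum, ← Finset.sum_add_distrib]
      refine Finset.sum_le_sum fun v _ => ?_
      rw [← mul_pow, hθy v]
      nlinarith [sq_nonneg (z v - ∑ w ∈ R, adj G v w * y w)]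
    have h2 := sum_sq_adj_le G R y
    have h3 : 0 ≤ ∑ v ∈ R, y v ^ 2 := Finset.sum_nonneg fun v _ => sq_nonneg _
    have h4 := mul_le_mul_of_nonneg_right hE h3
    have h5 := mul_le_mul_of_nonneg_right hEθ h3
    linarith
  refine ⟨hN1, ?_⟩
  have hX : θ * ∑ v ∈ R, b v * y v = ∑ v ∈ R, b v * z v + ∑ v ∈ R, z v * y v := by
    have := sum_mul_adj_comm G R b y
    simp only [hzv] at this
    rw [← this, Finset.mul_sum, ← Finset.sum_add_distrib]
    refine Finset.sum_congr rfl fun v _ => ?_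
    rw [← mul_add, ← hθy v]
    ring
  have hbz : |∑ v ∈ R, b v * z v| ≤ M * E := by
    have h1 : |∑ v ∈ R, b v * z v| ≤ ∑ v ∈ R, ∑ w ∈ R, M * adj G v w := by
      refine (Finset.abs_sum_le_sum_abs _ _).trans (Finset.sum_le_sum fun v hv => ?_)
      rw [← hzv v, Finset.mul_sum]
      refine (Finset.abs_sum_le_sum_abs _ _).trans (Finset.sum_le_sum fun w hw => ?_)
      rw [abs_mul, abs_mul, abs_of_nonneg (adj_nonneg G v w)]
      have h2 := mul_le_mul (habs v hv) (habs w hw) (abs_nonneg _) (Real.sqrt_nonneg M)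
      rw [Real.mul_self_sqrt hM] at h2
      have h3 := mul_le_mul_of_nonneg_left h2 (adj_nonneg G v w)
      linarith
    simp only [← Finset.mul_sum] at h1
    exact h1.trans (mul_le_mul_of_nonneg_left hE hM)
  have hzy : |∑ v ∈ R, z v * y v| ≤ 2 * (M * Δ * E) / |θ| := by
    rw [le_div_iff₀ hθa]
    have hK : 0 ≤ M * Δ * E := by positivity
    have h1 : (∑ v ∈ R, z v * y v) ^ 2 ≤ (∑ v ∈ R, z v ^ 2) * ∑ v ∈ R, y v ^ 2 :=
      Finset.sum_mul_sq_le_sq_mul_sq _ _ _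
    have h2 : (∑ v ∈ R, z v ^ 2) * ∑ v ∈ R, y v ^ 2 ≤ (M * Δ * E) * ∑ v ∈ R, y v ^ 2 :=
      mul_le_mul_of_nonneg_right hN2 (Finset.sum_nonneg fun v _ => sq_nonneg _)
    rw [← abs_mul]
    apply abs_le_of_sq_le_sq _ (by positivity)
    have h3 := mul_le_mul_of_nonneg_left hN1 hK
    have h4 := mul_le_mul_of_nonneg_left (h1.trans h2) hθ2.le
    calc ((∑ v ∈ R, z v * y v) * θ) ^ 2 = θ ^ 2 * (∑ v ∈ R, z v * y v) ^ 2 := by ring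
      _ ≤ θ ^ 2 * ((M * Δ * E) * ∑ v ∈ R, y v ^ 2) := h4
      _ = (M * Δ * E) * (θ ^ 2 * ∑ v ∈ R, y v ^ 2) := by ring
      _ ≤ (M * Δ * E) * (4 * (M * Δ * E)) := h3
      _ = (2 * (M * Δ * E)) ^ 2 := by ring
  have h1 : |θ| * |∑ v ∈ R, b v * y v| ≤ M * E + 2 * (M * Δ * E) / |θ| := by
    rw [← abs_mul, hX]
    exact (abs_add_le _ _).trans (add_le_add hbz hzy)
  have h2 : M * E * (1 / |θ| + 2 * Δ / θ ^ 2) = (M * E + 2 * (M * Δ * E) / |θ|) / |θ| := by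
    rw [← sq_abs θ]
    field_simp
  rw [h2, le_div_iff₀ hθa]
  linarith

end Perturbation

/-! ### Sparsity outside L and comparison of eigenvectors -/

section Structure

open Classical

/-- In a `K_{k+2}`-minor-free graph, two common neighbours of a `k`-set are neither adjacent nor
joined by a path of length two outside the set, provided there are many common neighbours. -/
theorem not_adj_of_dominated {V : Type*} {k r : ℕ} (hr : k + 2 = r) {G : SimpleGraph V}
    (hG : CompleteMinorFree r G) {L T : Finset V} (hL : L.card = k)
    (hT : ∀ v ∈ T, ∀ u ∈ L, G.Adj v u) (hTc : k + 3 ≤ T.card) {a b v : V} (ha : a ∈ T) (hb : b ∈ T)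
    (hv : v ∉ L) (hab : a ≠ b) (hbv : b = v ∨ G.Adj b v) : ¬ G.Adj a v := by
  intro hav
  have hTL : ∀ x ∈ T, ∀ u ∈ L, x ≠ u := fun x hx u hu => (hT x hx u hu).ne
  obtain ⟨l⟩ : Nonempty (Fin k ↪ L) :=
    Function.Embedding.nonempty_of_card_le (by simp [hL])
  -- The bound k + 3 leaves k vertices to pair with L after discarding a, b and v.
  have hcard : k ≤ (T \ {a, b, v}).card := by
    have h1 := Finset.le_card_sdiff {a, b, v} T
    have h2 : ({a, b, v} : Finset V).card ≤ 3 := Finset.card_le_three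
    omega
  obtain ⟨t⟩ : Nonempty (Fin k ↪ (T \ {a, b, v} : Finset V)) :=
    Function.Embedding.nonempty_of_card_le (by simpa using hcard)
  have htT : ∀ i, (t i : V) ∈ T := fun i => (Finset.mem_sdiff.mp (t i).2).1
  have htn : ∀ i, a ≠ t i ∧ b ≠ t i ∧ v ≠ t i := by
    intro i
    have := (Finset.mem_sdiff.mp (t i).2).2
    simp only [Finset.mem_insert, Finset.mem_singleton, not_or] at this
    exact ⟨Ne.symm this.1, Ne.symm this.2.1, Ne.symm this.2.2⟩
  refine hG (isMinor_of_biclique hr (fun i => (l i : V)) (fun i => (t i : V)) a b v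
    (fun i j h => l.injective (Subtype.ext h)) (fun i j h => t.injective (Subtype.ext h))
    (fun i j => (hT _ (htT j) _ (l i).2).symm) (fun i => Or.inl (hT a ha _ (l i).2))
    (fun i => Or.inl (hT b hb _ (l i).2)) hbv hav hab (fun i => hTL a ha _ (l i).2)
    (fun i => (htn i).1) (fun i => hTL b hb _ (l i).2) (fun i => (htn i).2.1)
    (fun i h => hv (h ▸ (l i).2)) (fun i => (htn i).2.2))

/-- By `not_adj_of_dominated` the common neighbours of L are independent, and a vertex of W has at
most one neighbour among them. The edges inside W are bounded by the linear edge bound. -/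
theorem sum_sum_compl_le {V : Type*} [Fintype V] [DecidableEq V] {k r : ℕ} (hr : k + 2 = r)
    {G : SimpleGraph V} (hG : CompleteMinorFree r G) {c : ℕ}
    (hc : ∀ S : Finset V, S.Nonempty → pairs G S < c * S.card) {L W : Finset V} (hL : L.card = k)
    (hW : W ⊆ Lᶜ) (hT : ∀ v ∈ Lᶜ \ W, ∀ u ∈ L, G.Adj v u) (hTc : k + 3 ≤ (Lᶜ \ W).card) :
    (∀ a ∈ Lᶜ \ W, ∀ b ∈ Lᶜ \ W, ¬ G.Adj a b) ∧
    (∀ v ∈ Lᶜ, ∑ w ∈ Lᶜ, adj G v w ≤ 2 * (W.card : ℝ)) ∧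
    ∑ v ∈ Lᶜ, ∑ w ∈ Lᶜ, adj G v w ≤ ((c : ℝ) + 2) * W.card := by
  have hind : ∀ a ∈ Lᶜ \ W, ∀ b ∈ Lᶜ \ W, ¬ G.Adj a b := by
    intro a ha b hb hab
    exact not_adj_of_dominated hr hG hL hT hTc ha hb
      (Finset.mem_compl.mp (Finset.mem_sdiff.mp hb).1) hab.ne (Or.inl rfl) hab
  have hTT : ∀ a ∈ Lᶜ \ W, ∑ b ∈ Lᶜ \ W, adj G a b = 0 := fun a ha =>
    Finset.sum_eq_zero fun b hb => adj_of_not_adj (hind a ha b hb)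
  have hle : ∀ v, ∑ w ∈ W, adj G v w ≤ (W.card : ℝ) := fun v => by
    calc _ ≤ ∑ w ∈ W, (1 : ℝ) := Finset.sum_le_sum fun w _ => adj_le_one G v w
      _ = _ := by simp
  have hWT : ∀ v ∈ W, ∑ b ∈ Lᶜ \ W, adj G v b ≤ 1 := by
    intro v hv
    rw [← cast_card_filter_adj]
    have : ((Lᶜ \ W).filter (G.Adj v)).card ≤ 1 := by
      rw [Finset.card_le_one]
      intro a ha b hb
      rw [Finset.mem_filter] at ha hb
      by_contra hab
      exact not_adj_of_dominated hr hG hL hT hTc ha.1 hb.1 (Finset.mem_compl.mp (hW hv)) hab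
        (Or.inr hb.2.symm) ha.2.symm
    exact_mod_cast this
  have hsplit : ∀ f : V → ℝ, ∑ w ∈ Lᶜ, f w = ∑ w ∈ Lᶜ \ W, f w + ∑ w ∈ W, f w := fun f =>
    (Finset.sum_sdiff hW).symm
  refine ⟨hind, fun v hv => ?_, ?_⟩
  · rw [hsplit]
    by_cases hvW : v ∈ W
    · have h1 : (1 : ℝ) ≤ W.card := by exact_mod_cast Finset.card_pos.mpr ⟨v, hvW⟩
      have := hWT v hvW
      have := hle v
      linarith
    · rw [hTT v (Finset.mem_sdiff.mpr ⟨hv, hvW⟩)]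
      have := hle v
      have : (0 : ℝ) ≤ W.card := Nat.cast_nonneg _
      linarith
  · simp only [hsplit, Finset.sum_add_distrib]
    rw [Finset.sum_eq_zero hTT]
    have h1 : ∑ v ∈ W, ∑ b ∈ Lᶜ \ W, adj G v b ≤ (W.card : ℝ) := by
      calc _ ≤ ∑ v ∈ W, (1 : ℝ) := Finset.sum_le_sum hWT
        _ = _ := by simp
    have h2 : ∑ v ∈ Lᶜ \ W, ∑ b ∈ W, adj G v b = ∑ v ∈ W, ∑ b ∈ Lᶜ \ W, adj G v b :=
      Finset.sum_comm.trans
        (Finset.sum_congr rfl fun v _ => Finset.sum_congr rfl fun b _ => adj_symm G b v)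
    have h3 : ∑ v ∈ W, ∑ b ∈ W, adj G v b ≤ (c : ℝ) * W.card := by
      rw [← cast_pairs]
      rcases W.eq_empty_or_nonempty with h | h
      · simp [h, pairs]
      · exact_mod_cast (hc W h).le
    rw [h2]
    linarith

theorem sum_adj_quadForm_le {V : Type*} (G : SimpleGraph V) (L : Finset V) (x : V → ℝ) :
    |∑ u ∈ L, ∑ v ∈ L, adj G u v * (x u * x v)| ≤ L.card * ∑ u ∈ L, x u ^ 2 := by
  have h1 : |∑ u ∈ L, ∑ v ∈ L, adj G u v * (x u * x v)| ≤ (∑ u ∈ L, |x u|) ^ 2 := by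
    rw [sq, Finset.sum_mul_sum]
    refine (Finset.abs_sum_le_sum_abs _ _).trans (Finset.sum_le_sum fun u _ => ?_)
    refine (Finset.abs_sum_le_sum_abs _ _).trans (Finset.sum_le_sum fun v _ => ?_)
    rw [abs_mul, abs_mul, abs_of_nonneg (adj_nonneg G u v)]
    exact mul_le_of_le_one_left (by positivity) (adj_le_one G u v)
  refine h1.trans (sq_sum_le_card_mul_sum_sq.trans_eq ?_)
  simp only [sq_abs]

set_option maxHeartbeats 800000 in
/-- Consequences of the eigenvalue equation for a graph in which a `k`-set `L` dominates all but
the few vertices in `W` and the complement of `L` is sparse. -/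
theorem eigen_estimates {V : Type*} [Fintype V] [DecidableEq V] {k : ℕ} (hk : 1 ≤ k)
    {G : SimpleGraph V} {L W : Finset V} (hL : L.card = k) (hW : W ⊆ Lᶜ)
    (hT : ∀ v ∈ Lᶜ \ W, ∀ u ∈ L, G.Adj v u) (hW' : ∀ v ∈ W, ∃ u ∈ L, ¬ G.Adj v u) {C n δ : ℝ}
    (hC : 1 ≤ C) (hδ : 512 * C * k * δ ≤ 1) (hn : (Fintype.card V : ℝ) = n)
    (hn0 : 0 < n) (hWn : (W.card : ℝ) ≤ δ * n)
    (hΔ : ∀ v ∈ Lᶜ, ∑ w ∈ Lᶜ, adj G v w ≤ 2 * (W.card : ℝ))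
    (hE : ∑ v ∈ Lᶜ, ∑ w ∈ Lᶜ, adj G v w ≤ C * W.card) {θ : ℝ} {x : V → ℝ} (hx : x ≠ 0)
    (hθ : adj G *ᵥ x = θ • x) (hθ1 : k * n / 2 ≤ θ ^ 2) (hθ2 : 512 * k ^ 2 ≤ |θ|)
    (hθ3 : 8 * k * C ≤ |θ|) :
    θ ^ 2 ≤ k * |θ| + k * n + 2 * k * W.card ∧
    (W.Nonempty → (1 - 1 / (16 * k)) * (k * n) ≤ θ ^ 2 →
      ∃ x' : V → ℝ, x' ≠ 0 ∧ θ ^ 2 * (x' ⬝ᵥ x') < θ * (x' ⬝ᵥ adj (joinOn G L) *ᵥ x')) := by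
  have hkR : (1 : ℝ) ≤ k := by exact_mod_cast hk
  have hθpos : 0 < |θ| := lt_of_lt_of_le (by positivity) hθ2
  have hθ0 : θ ≠ 0 := abs_pos.mp hθpos
  have hθsq : 0 < θ ^ 2 := by positivity
  obtain ⟨w, hw⟩ : ∃ w : ℝ, w = W.card := ⟨_, rfl⟩
  rw [← hw] at hWn hΔ hE ⊢
  have hw0 : 0 ≤ w := hw ▸ Nat.cast_nonneg _
  obtain ⟨P, hP⟩ : ∃ P, P = ∑ u ∈ L, x u ^ 2 := ⟨_, rfl⟩
  obtain ⟨s, hs⟩ : ∃ s, s = ∑ u ∈ L, x u := ⟨_, rfl⟩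
  obtain ⟨b, hb⟩ : ∃ b : V → ℝ, b = fun v => ∑ u ∈ L, adj G v u * x u := ⟨_, rfl⟩
  have hbv : ∀ v, ∑ u ∈ L, adj G v u * x u = b v := fun v => by rw [hb]
  have hP0 : 0 ≤ P := hP ▸ Finset.sum_nonneg fun v _ => sq_nonneg _
  have hδn : 512 * C * k * w ≤ n := by
    have := mul_le_mul_of_nonneg_left hWn (by positivity : 0 ≤ 512 * C * k)
    nlinarith
  have heq : ∀ v, θ * x v = b v + ∑ w ∈ Lᶜ, adj G v w * x w := by
    intro v
    have := congrFun hθ v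
    rw [Pi.smul_apply, smul_eq_mul, Matrix.mulVec, dotProduct, ← Finset.sum_add_sum_compl L,
      hbv] at this
    exact this.symm
  have hb2 : ∀ v, b v ^ 2 ≤ k * P := by
    intro v
    rw [← hbv v, sum_adj_mul]
    refine sq_sum_le_card_mul_sum_sq.trans ?_
    rw [hP, ← hL]
    refine mul_le_mul (by exact_mod_cast Finset.card_filter_le _ _) ?_
      (Finset.sum_nonneg fun v _ => sq_nonneg _) (Nat.cast_nonneg _)
    exact Finset.sum_le_sum_of_subset_of_nonneg (Finset.filter_subset _ _)
      fun v _ _ => sq_nonneg _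
  have hbW : ∀ v ∈ W, b v ^ 2 ≤ (k - 1) * P := by
    intro v hv
    obtain ⟨u, hu, huv⟩ := hW' v hv
    rw [← hbv v, sum_adj_mul]
    refine sq_sum_le_card_mul_sum_sq.trans ?_
    have h1 : (L.filter (G.Adj v)).card < k := by
      rw [← hL]
      exact Finset.card_lt_card (Finset.filter_ssubset.mpr ⟨u, hu, huv⟩)
    have h2 : ((L.filter (G.Adj v)).card : ℝ) + 1 ≤ k := by exact_mod_cast h1
    rw [hP]
    refine mul_le_mul (by linarith) ?_
      (Finset.sum_nonneg fun v _ => sq_nonneg _) (by linarith)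
    exact Finset.sum_le_sum_of_subset_of_nonneg (Finset.filter_subset _ _)
      fun v _ _ => sq_nonneg _
  have hbT : ∀ v ∈ Lᶜ \ W, b v = s := by
    intro v hv
    rw [← hbv v, hs]
    exact Finset.sum_congr rfl fun u hu => by rw [adj_of_adj (hT v hv u hu), one_mul]
  have hs2 : s ^ 2 ≤ k * P := by
    rw [hs, hP, ← hL]
    exact sq_sum_le_card_mul_sum_sq
  have hEθ : 4 * (C * w) ≤ θ ^ 2 := by nlinarith
  obtain ⟨hN, hX⟩ := sparse_perturbation G Lᶜ hθ0 (fun v _ => heq v)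
    (by positivity : 0 ≤ k * P) (fun v _ => hb2 v) hΔ hE hEθ (by positivity)
  obtain ⟨X, hXdef⟩ : ∃ X, X = ∑ v ∈ Lᶜ, b v * ∑ w ∈ Lᶜ, adj G v w * x w := ⟨_, rfl⟩
  rw [← hXdef] at hX
  have hXle : |X| ≤ P * w / 4 := by
    have h1 : 1 / |θ| ≤ 1 / (8 * k * C) := one_div_le_one_div_of_le (by positivity) hθ3
    have h2 : 2 * (2 * w) / θ ^ 2 ≤ 1 / (8 * k * C) := by
      rw [div_le_div_iff₀ hθsq (by positivity)]
      nlinarith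
    have h3 : k * P * (C * w) * (1 / |θ| + 2 * (2 * w) / θ ^ 2) ≤
        k * P * (C * w) * (1 / (8 * k * C) + 1 / (8 * k * C)) :=
      mul_le_mul_of_nonneg_left (add_le_add h1 h2) (by positivity)
    have h4 : k * P * (C * w) * (1 / (8 * k * C) + 1 / (8 * k * C)) = P * w / 4 := by
      field_simp
      ring
    linarith
  -- If x vanished on L, then b = 0, the perturbation bound would give A_R x = 0 for R = Lᶜ, and x
  -- would be zero.
  have hPpos : 0 < P := by
    refine lt_of_le_of_ne hP0 fun h0 => hx ?_
    have hxL : ∀ u ∈ L, x u = 0 := by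
      intro u hu
      rw [hP] at h0
      have := (Finset.sum_eq_zero_iff_of_nonneg fun v _ => sq_nonneg _).mp h0.symm u hu
      exact pow_eq_zero_iff (two_ne_zero) |>.mp this
    rw [← h0] at hN
    have h1 : ∑ v ∈ Lᶜ, (∑ w ∈ Lᶜ, adj G v w * x w) ^ 2 = 0 := by
      have h2 : 0 ≤ ∑ v ∈ Lᶜ, (∑ w ∈ Lᶜ, adj G v w * x w) ^ 2 :=
        Finset.sum_nonneg fun v _ => sq_nonneg _
      nlinarith
    funext v
    by_cases hv : v ∈ L
    · exact hxL v hv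
    · have h2 := (Finset.sum_eq_zero_iff_of_nonneg fun v _ => sq_nonneg _).mp h1 v
        (Finset.mem_compl.mpr hv)
      have h3 : b v = 0 := by
        rw [← hbv v]
        exact Finset.sum_eq_zero fun u hu => by rw [hxL u hu, mul_zero]
      have h4 := heq v
      rw [h3, pow_eq_zero_iff (two_ne_zero) |>.mp h2, add_zero] at h4
      exact (mul_eq_zero.mp h4).resolve_left hθ0
  obtain ⟨q, hq⟩ : ∃ q, q = ∑ u ∈ L, ∑ v ∈ L, adj G u v * (x u * x v) := ⟨_, rfl⟩
  have hqle : |q| ≤ k * P := by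
    rw [hq, hP, ← hL]
    exact sum_adj_quadForm_le G L x
  have hxb : θ * P = q + ∑ v ∈ Lᶜ, x v * b v := by
    have h1 : ∑ v ∈ Lᶜ, x v * b v = ∑ u ∈ L, x u * ∑ v ∈ Lᶜ, adj G u v * x v := by
      simp only [← hbv, Finset.mul_sum]
      rw [Finset.sum_comm]
      exact Finset.sum_congr rfl fun u _ => Finset.sum_congr rfl fun v _ => by
        rw [adj_symm]; ring
    rw [h1, hq, hP, Finset.mul_sum, ← Finset.sum_add_distrib]
    refine Finset.sum_congr rfl fun u _ => ?_
    have h2 : ∑ v ∈ L, adj G u v * (x u * x v) = x u * b u := by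
      rw [← hbv u, Finset.mul_sum]
      exact Finset.sum_congr rfl fun v _ => by ring
    rw [h2, ← mul_add, ← heq u]
    ring
  have hθxb : θ * ∑ v ∈ Lᶜ, x v * b v = ∑ v ∈ Lᶜ, b v ^ 2 + X := by
    rw [hXdef, Finset.mul_sum, ← Finset.sum_add_distrib]
    refine Finset.sum_congr rfl fun v _ => ?_
    have := heq v
    linear_combination b v * this
  -- The identity behind both conclusions: off L, b equals s except on W, where b² ≤ (k-1)P, and X
  -- is a small error.
  have hmain : θ ^ 2 * P = θ * q + ∑ v ∈ Lᶜ, b v ^ 2 + X := by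
    linear_combination θ * hxb + hθxb
  have hθq : |θ * q| ≤ |θ| * (k * P) := by
    rw [abs_mul]
    exact mul_le_mul_of_nonneg_left hqle hθpos.le
  have hsumb : ∑ v ∈ Lᶜ, b v ^ 2 = ((Lᶜ \ W).card : ℝ) * s ^ 2 + ∑ v ∈ W, b v ^ 2 := by
    rw [← Finset.sum_sdiff hW, Finset.sum_congr rfl fun v hv => by rw [hbT v hv],
      Finset.sum_const, nsmul_eq_mul]
  have hcardT : ((Lᶜ \ W).card : ℝ) ≤ n := by
    rw [← hn]
    exact_mod_cast Finset.card_le_univ _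
  have hsumW : ∑ v ∈ W, b v ^ 2 ≤ w * ((k - 1) * P) := by
    have := Finset.sum_le_card_nsmul _ _ _ hbW
    rwa [nsmul_eq_mul, ← hw] at this
  have hsumle : ∑ v ∈ Lᶜ, b v ^ 2 ≤ n * s ^ 2 + w * ((k - 1) * P) := by
    rw [hsumb]
    exact add_le_add (mul_le_mul_of_nonneg_right hcardT (sq_nonneg s)) hsumW
  obtain ⟨hX1, hX2⟩ := abs_le.mp hXle
  obtain ⟨hq1, hq2⟩ := abs_le.mp hθq
  have hwP : 0 ≤ w * P := by positivity
  refine ⟨?_, ?_⟩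
  · have h1 : n * s ^ 2 ≤ n * (k * P) := mul_le_mul_of_nonneg_left hs2 hn0.le
    have h2 : θ ^ 2 * P ≤ (k * |θ| + k * n + 2 * k * w) * P := by
      have h3 : 0 ≤ k * (w * P) := by positivity
      linarith
    exact le_of_mul_le_mul_right h2 hPpos
  · intro hne hθ4
    have hwpos : 0 < w := by
      rw [hw]
      exact_mod_cast hne.card_pos
    -- When θ² is close to kn, the identity for θ²P forces s² close to its maximum kP, all other
    -- terms being small.
    have hs2low : (k - 1 / 4) * P ≤ s ^ 2 := by
      have h0 : (1 - 1 / (16 * k)) * (k * n) = (k - 1 / 16) * n := by field_simp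
      rw [h0] at hθ4
      have h1 : k * |θ| ≤ θ ^ 2 * (1 / (512 * k)) := by
        rw [← sq_abs, mul_one_div, le_div_iff₀ (by positivity)]
        have := mul_le_mul_of_nonneg_right hθ2 hθpos.le
        linarith
      have h2 : θ ^ 2 * (1 - 1 / (512 * k)) ≥ (k - 1 / 8) * n := by
        have h3 : 0 ≤ 1 - 1 / (512 * (k : ℝ)) := by
          rw [sub_nonneg, div_le_one (by positivity)]
          linarith
        have h4 := mul_le_mul_of_nonneg_right hθ4 h3
        have h5 : (k - 1 / 16) * n * (1 - 1 / (512 * (k : ℝ))) =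
            (k - 1 / 16) * n - (n / 512 - n / (512 * 16 * k)) := by
          field_simp
        have h6 : 0 ≤ n / (512 * 16 * k) := by positivity
        linarith
      have h3 : 512 * k * w ≤ n := by
        have := mul_nonneg (sub_nonneg.mpr hC) (by positivity : 0 ≤ 512 * k * w)
        linarith
      have h4 : (k - 1 / 8) * n * P ≤ θ ^ 2 * P - |θ| * (k * P) := by
        have h6 := mul_le_mul_of_nonneg_right h1 hP0
        have h7 := mul_le_mul_of_nonneg_right h2 hP0
        linarith
      have h5 : n * ((k - 1 / 4) * P) ≤ n * s ^ 2 := by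
        have h6 := mul_le_mul_of_nonneg_right h3 hP0
        have h7 : 0 ≤ n * P := by positivity
        linarith
      exact le_of_mul_le_mul_left h5 hn0
    have hcardR : (Lᶜ.card : ℝ) = (Lᶜ \ W).card + w := by
      rw [hw]
      exact_mod_cast (Finset.card_sdiff_add_card_eq_card hW).symm
    -- Joining a vertex of W to all of L gains s² - b_v² ≥ 3P/4, so W gains at least 3Pw/4, against
    -- |X| ≤ Pw/4.
    have hgain : θ * ∑ v ∈ Lᶜ, x v * b v < Lᶜ.card * s ^ 2 := by
      rw [hθxb, hsumb, hcardR]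
      have h1 := mul_le_mul_of_nonneg_left hs2low hwpos.le
      have h2 : 0 < w * P := mul_pos hwpos hPpos
      linarith
    -- The value s/θ is what the eigenvalue equation of the join prescribes off L. The factor θ in
    -- the claim lets one argument serve both signs.
    refine ⟨fun v => if v ∈ L then x v else s / θ, ?_, ?_⟩
    · intro h0
      have h1 : P = 0 := by
        rw [hP]
        refine Finset.sum_eq_zero fun u hu => ?_
        have := congrFun h0 u
        simp only [hu, if_true, Pi.zero_apply] at this
        rw [this]
        norm_num
      linarith
    · rw [dotProduct_self_of_const L _ (s / θ) fun v hv => if_neg hv,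
        quadForm_joinOn G L _ (s / θ) fun v hv => if_neg hv]
      have e1 : ∑ u ∈ L, (if u ∈ L then x u else s / θ) ^ 2 = P := by
        rw [hP]
        exact Finset.sum_congr rfl fun u hu => by rw [if_pos hu]
      have e2 : ∑ u ∈ L, (if u ∈ L then x u else s / θ) = s := by
        rw [hs]
        exact Finset.sum_congr rfl fun u hu => by rw [if_pos hu]
      have e3 : ∑ u ∈ L, ∑ v ∈ L, adj G u v *
          ((if u ∈ L then x u else s / θ) * (if v ∈ L then x v else s / θ)) = q := by
        rw [hq]
        exact Finset.sum_congr rfl fun u hu => Finset.sum_congr rfl fun v hv => by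
          rw [if_pos hu, if_pos hv]
      rw [e1, e2, e3]
      have e4 : θ ^ 2 * (P + Lᶜ.card * (s / θ) ^ 2) = θ ^ 2 * P + Lᶜ.card * s ^ 2 := by
        field_simp
      have e5 : θ * (q + 2 * (Lᶜ.card * (s / θ) * s)) = θ * q + 2 * (Lᶜ.card * s ^ 2) := by
        field_simp
      rw [e4, e5]
      have e6 : θ ^ 2 * P = θ * q + θ * ∑ v ∈ Lᶜ, x v * b v := by
        linear_combination θ * hxb
      linarith

end Structure

/-! ### Extremal graphs are joins -/

section Extremal

open Classical

/-- For l the top eigenvalue and -m the bottom one: as l cannot exceed √(kn) by much, a sum of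
nearly 2√(kn) forces m to be nearly √(kn) too. -/
theorem sq_ge_of_add_ge {k n w l m : ℝ} (hk : 1 ≤ k) (hn : 128 * k ^ 2 ≤ n)
    (hw : 512 * k * w ≤ n) (hl : 512 * k ^ 2 ≤ l) (hl2 : l ^ 2 ≤ k * l + k * n + 2 * k * w)
    (hlm : 2 * √(k * (n - k)) ≤ l + m) :
    0 < m ∧ (1 - 1 / (16 * k)) * (k * n) ≤ m ^ 2 := by
  obtain ⟨t, ht⟩ : ∃ t, t = 1 / (16 * k) := ⟨_, rfl⟩
  have htk : t * k = 1 / 16 := by rw [ht]; field_simp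
  have ht0 : 0 < t := by rw [ht]; positivity
  have ht1 : t ≤ 1 / 16 := by nlinarith
  have hn0 : 0 < n := lt_of_lt_of_le (by positivity) hn
  obtain ⟨q, hq⟩ : ∃ q, q = √(k * n) := ⟨_, rfl⟩
  have hq0 : 0 < q := hq ▸ Real.sqrt_pos.mpr (by positivity)
  have hq2 : q ^ 2 = k * n := hq ▸ Real.sq_sqrt (by positivity)
  have hkn : k * k ≤ t / 8 * (k * n) := by
    have : t / 8 * (k * n) = n / 128 := by linear_combination n / 8 * htk
    rw [this]
    linarith
  have hg : (1 - t / 8) * q ≤ √(k * (n - k)) := by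
    apply Real.le_sqrt_of_sq_le
    rw [mul_pow, hq2]
    have h1 : (1 - t / 8) ^ 2 ≤ 1 - t / 8 := by nlinarith
    have h2 := mul_le_mul_of_nonneg_right h1 (by positivity : 0 ≤ k * n)
    linarith
  have hl0 : 0 < l := lt_of_lt_of_le (by positivity) hl
  have hlq : l ≤ (1 + t / 8) * q := by
    by_contra hcon
    push Not at hcon
    have h1 : ((1 + t / 8) * q) ^ 2 < l ^ 2 := pow_lt_pow_left₀ hcon (by positivity) two_ne_zero
    rw [mul_pow, hq2] at h1
    have h2 : k * l ≤ t / 32 * l ^ 2 := by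
      have h3 := mul_le_mul_of_nonneg_left hl (by positivity : 0 ≤ t / 32 * l)
      have h4 : t / 32 * l * (512 * k ^ 2) = k * l := by linear_combination 16 * k * l * htk
      linarith
    have h3 : 2 * k * w ≤ t / 16 * (k * n) := by
      have : t / 16 * (k * n) = n / 256 := by linear_combination n / 16 * htk
      rw [this]
      linarith
    have h4 : (1 + t / 16) ≤ (1 + t / 8) ^ 2 * (1 - t / 32) := by nlinarith
    have h5 := mul_le_mul_of_nonneg_right h4 (by positivity : 0 ≤ k * n)
    have h6 := mul_lt_mul_of_pos_right h1 (by linarith : 0 < 1 - t / 32)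
    linarith
  have hm : (1 - 3 * t / 8) * q ≤ m := by linarith
  have hpos : 0 < (1 - 3 * t / 8) * q := mul_pos (by linarith) hq0
  refine ⟨lt_of_lt_of_le hpos hm, ?_⟩
  have h1 := pow_le_pow_left₀ hpos.le hm 2
  rw [mul_pow, hq2] at h1
  have h2 : 1 - t ≤ (1 - 3 * t / 8) ^ 2 := by nlinarith
  have h3 := mul_le_mul_of_nonneg_right h2 (by positivity : 0 ≤ k * n)
  rw [← ht]
  linarith

theorem IsMaxSpread.two_mul_sqrt_le {k r n : ℕ} (hk : 1 ≤ k) (hr : k + 2 = r) (hn : k < n)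
    {G : SimpleGraph (Fin n)} (hG : IsMaxSpread r G) :
    2 * √((k : ℝ) * (n - k)) ≤ spread G := by
  obtain ⟨L, -, hL⟩ := Finset.exists_subset_card_eq
    (s := (Finset.univ : Finset (Fin n))) (n := k) (by simpa using hn.le)
  have hLc : Lᶜ.card = n - k := by rw [Finset.card_compl, Fintype.card_fin, hL]
  have h := le_spread_joinOn G L (by omega) (by omega)
  rw [hL, hLc, Nat.cast_sub hn.le] at h
  exact h.trans (hG.2 _ (joinOn_completeMinorFree hr G L hL))

set_option maxHeartbeats 1600000 in
/-- A `K_{k+2}`-minor-free graph of maximum spread is the join of a graph on `k` vertices and an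
independent set. -/
theorem exists_join_structure {k r : ℕ} (hk : 1 ≤ k) (hr : k + 2 = r) :
    ∃ N : ℕ, ∀ n ≥ N, ∀ G : SimpleGraph (Fin n), IsMaxSpread r G →
      ∃ L : Finset (Fin n), L.card = k ∧ (∀ v ∉ L, ∀ u ∈ L, G.Adj v u) ∧
        ∀ v ∉ L, ∀ w ∉ L, ¬ G.Adj v w := by
  have hkR : (1 : ℝ) ≤ k := by exact_mod_cast hk
  obtain ⟨c, hc⟩ := CompleteMinorFree.exists_pairs_lt r
  obtain ⟨C, hC⟩ : ∃ C : ℝ, C = c + 2 := ⟨_, rfl⟩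
  have hC1 : 1 ≤ C := by
    have : (0 : ℝ) ≤ c := Nat.cast_nonneg _
    linarith
  obtain ⟨δ, hδ⟩ : ∃ δ : ℝ, δ = 1 / (512 * C * k) := ⟨_, rfl⟩
  have hδ0 : 0 < δ := by rw [hδ]; positivity
  have hδ1 : 512 * C * k * δ ≤ 1 := by
    rw [hδ]
    exact (by field_simp : 512 * C * k * (1 / (512 * C * k)) = 1).le
  obtain ⟨N, hN⟩ := exists_dominating_set hk hr hδ0
  obtain ⟨Y, hY⟩ : ∃ Y : ℝ, Y = 512 * k ^ 2 + 8 * k * C := ⟨_, rfl⟩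
  have hY0 : 0 ≤ Y := by rw [hY]; positivity
  -- n ≥ 2Y² turns θ² ≥ kn/2 into |θ| ≥ Y, which covers both lower bounds on |θ| in
  -- `eigen_estimates`.
  refine ⟨N + ⌈2 * Y ^ 2⌉₊ + 128 * k ^ 2 + 4 * k + 6, fun n hn G hG => ?_⟩
  have hkn : 2 * k < n := by omega
  have hn1 : 2 * Y ^ 2 ≤ n := Nat.ceil_le.mp (by omega)
  have hn2 : 128 * (k : ℝ) ^ 2 ≤ n := by
    have : 128 * k ^ 2 ≤ n := by omega
    exact_mod_cast this
  have hkn' : 2 * (k : ℝ) ≤ n := by exact_mod_cast hkn.le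
  have hn0 : (0 : ℝ) < n := by linarith
  have : Nonempty (Fin n) := ⟨⟨0, by omega⟩⟩
  have hspread := hG.two_mul_sqrt_le hk hr (by omega)
  obtain ⟨L, hL, hLδ⟩ := hN n (by omega) G hG.1 hspread
  obtain ⟨W, hW⟩ : ∃ W : Finset (Fin n), W =
    Finset.univ.filter fun v => v ∉ L ∧ ¬ ∀ u ∈ L, G.Adj v u := ⟨_, rfl⟩
  rw [← hW] at hLδ
  have hWL : W ⊆ Lᶜ := fun v hv => by
    rw [hW, Finset.mem_filter] at hv
    exact Finset.mem_compl.mpr hv.2.1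
  have hT : ∀ v ∈ Lᶜ \ W, ∀ u ∈ L, G.Adj v u := by
    intro v hv
    simp only [hW, Finset.mem_sdiff, Finset.mem_compl, Finset.mem_filter, Finset.mem_univ,
      true_and, not_and, not_not] at hv
    exact hv.2 hv.1
  have hW' : ∀ v ∈ W, ∃ u ∈ L, ¬ G.Adj v u := by
    intro v hv
    rw [hW, Finset.mem_filter] at hv
    simpa using hv.2.2
  have hw512 : 512 * k * (W.card : ℝ) ≤ n := by
    have h1 := mul_le_mul_of_nonneg_left hLδ (by positivity : (0 : ℝ) ≤ 512 * C * k)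
    have h2 := mul_le_mul_of_nonneg_right hδ1 hn0.le
    have h3 := mul_le_mul_of_nonneg_right hC1 (by positivity : 0 ≤ 512 * k * (W.card : ℝ))
    linarith
  have hTc : k + 3 ≤ (Lᶜ \ W).card := by
    have h1 := Finset.card_sdiff_add_card_eq_card hWL
    rw [Finset.card_compl, Fintype.card_fin, hL] at h1
    have h2 : 512 * k * W.card ≤ n := by exact_mod_cast hw512
    have h3 : W.card ≤ k * W.card := Nat.le_mul_of_pos_left _ hk
    have h4 : 512 * W.card ≤ n := by nlinarith
    omega
  obtain ⟨hind, hΔ, hE⟩ := sum_sum_compl_le hr hG.1 (hc G hG.1) hL hWL hT hTc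
  rw [← hC] at hE
  have hA := adj_isHermitian G
  have hA' := adj_isHermitian (joinOn G L)
  obtain ⟨l, hl⟩ : ∃ l, l = sSup (spectrum ℝ (adj G)) := ⟨_, rfl⟩
  obtain ⟨m, hm⟩ : ∃ m, m = sInf (spectrum ℝ (adj G)) := ⟨_, rfl⟩
  have hlg : √((k : ℝ) * (n - k)) ≤ l := by
    obtain ⟨x, -, hx1, hx2⟩ := exists_nonneg_quadForm_ge G hspread
    have h1 := le_sSup_spectrum hA x
    rw [quadForm_adj, ← hl] at h1
    have h2 : x ⬝ᵥ x = 1 := by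
      rw [← hx1, dotProduct]
      exact Finset.sum_congr rfl fun v _ => by ring
    rw [h2, mul_one] at h1
    exact hx2.trans h1
  have hl0 : 0 ≤ l := (Real.sqrt_nonneg _).trans hlg
  have hl2 : (k : ℝ) * n / 2 ≤ l ^ 2 := by
    have h1 := (Real.sqrt_le_left hl0).mp hlg
    nlinarith
  have hlarge : ∀ θ : ℝ, (k : ℝ) * n / 2 ≤ θ ^ 2 → 512 * (k : ℝ) ^ 2 ≤ |θ| ∧ 8 * k * C ≤ |θ| := by
    intro θ hθ
    have h1 : Y ^ 2 ≤ θ ^ 2 := by nlinarith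
    have h2 : Y ≤ |θ| := by
      rw [← abs_of_nonneg hY0]
      exact sq_le_sq.mp h1
    have h3 : 0 ≤ 8 * k * C := by positivity
    have h4 : 0 ≤ 512 * (k : ℝ) ^ 2 := by positivity
    constructor <;> linarith
  have hcard : (Fintype.card (Fin n) : ℝ) = n := by rw [Fintype.card_fin]
  have key := fun (θ : ℝ) (x : Fin n → ℝ) (hx : x ≠ 0) (hθ : adj G *ᵥ x = θ • x)
    (hθ1 : (k : ℝ) * n / 2 ≤ θ ^ 2) => eigen_estimates hk hL hWL hT hW' hC1 hδ1 hcard hn0 hLδ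
      hΔ hE hx hθ hθ1 (hlarge θ hθ1).1 (hlarge θ hθ1).2
  obtain ⟨x, hx, hx'⟩ := exists_eigenvector_sSup hA
  obtain ⟨y, hy, hy'⟩ := exists_eigenvector_sInf hA
  rw [← hl] at hx'
  rw [← hm] at hy'
  -- If W is nonempty, passing to `joinOn G L` moves both ends of the spectrum strictly outward.
  have hWempty : W = ∅ := by
    by_contra hne
    have hne := Finset.nonempty_iff_ne_empty.mpr hne
    obtain ⟨k1, k2⟩ := key l x hx hx' hl2
    have hl512 := (hlarge l hl2).1
    rw [abs_of_nonneg hl0] at k1 hl512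
    have hsp : spread G = l - m := by rw [spread, hl, hm]
    have hτ : 0 < (1 : ℝ) - 1 / (16 * k) ∧ 1 / 2 ≤ (1 : ℝ) - 1 / (16 * k) := by
      have : 1 / (16 * (k : ℝ)) ≤ 1 / 16 := one_div_le_one_div_of_le (by norm_num) (by linarith)
      constructor <;> linarith
    have hkn0 : (0 : ℝ) ≤ k * n := by positivity
    have hlstrong : (1 - 1 / (16 * (k : ℝ))) * (k * n) ≤ l ^ 2 := by
      have h1 := (Real.sqrt_le_left hl0).mp hlg
      have h2 : (1 - 1 / (16 * (k : ℝ))) * (k * n) = k * n - n / 16 := by field_simp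
      rw [h2]
      nlinarith
    obtain ⟨m0, hm2⟩ := sq_ge_of_add_ge hkR hn2 hw512 hl512 k1
      (by rw [hsp] at hspread; linarith : 2 * √((k : ℝ) * (n - k)) ≤ l + -m)
    rw [neg_sq] at hm2
    obtain ⟨x₁, hx₁, hx₁'⟩ := k2 hne hlstrong
    have hm2' : (k : ℝ) * n / 2 ≤ m ^ 2 := by nlinarith
    obtain ⟨y₁, hy₁, hy₁'⟩ := (key m y hy hy' hm2').2 hne hm2
    have hlpos : 0 < l := lt_of_lt_of_le (by positivity) hl512
    have g1 : l < sSup (spectrum ℝ (adj (joinOn G L))) := by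
      have h1 := le_sSup_spectrum hA' x₁
      have h2 := dotProduct_self_pos hx₁
      have h3 : l * (x₁ ⬝ᵥ x₁) < x₁ ⬝ᵥ adj (joinOn G L) *ᵥ x₁ := by
        refine lt_of_mul_lt_mul_left ?_ hlpos.le
        linarith
      exact lt_of_mul_lt_mul_right (h3.trans_le h1) h2.le
    have g2 : sInf (spectrum ℝ (adj (joinOn G L))) < m := by
      have h1 := sInf_spectrum_le hA' y₁
      have h2 := dotProduct_self_pos hy₁
      have h3 : y₁ ⬝ᵥ adj (joinOn G L) *ᵥ y₁ < m * (y₁ ⬝ᵥ y₁) := by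
        refine lt_of_mul_lt_mul_left ?_ m0.le
        linarith
      exact lt_of_mul_lt_mul_right (h1.trans_lt h3) h2.le
    have h1 := hG.2 _ (joinOn_completeMinorFree hr G L hL)
    rw [hsp, spread] at h1
    linarith
  have hmem : ∀ v ∉ L, v ∈ Lᶜ \ W := fun v hv => by simp [hWempty, hv]
  exact ⟨L, hL, fun v hv => hT v (hmem v hv), fun v hv w hw => hind v (hmem v hv) w (hmem w hw)⟩

end Extremal

/-! ### Approximate roots of the quintic -/

section Asymptotics

/-- Compactness makes the error constants uniform in the coefficients a, b, e and in u = 1/g. -/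
theorem exists_abs_le_of_continuous {f : ℝ × ℝ × ℝ × ℝ → ℝ} (hf : Continuous f) (K : ℝ) :
    ∃ M : ℝ, 0 ≤ M ∧ ∀ a b e u : ℝ, |a| ≤ K → |b| ≤ K → |e| ≤ K → |u| ≤ 1 →
      |f (a, b, e, u)| ≤ M := by
  obtain ⟨M, hM⟩ := ((isCompact_Icc (a := -K) (b := K)).prod ((isCompact_Icc (a := -K) (b := K)).prod
    ((isCompact_Icc (a := -K) (b := K)).prod (isCompact_Icc (a := (-1 : ℝ)) (b := 1))))
    ).exists_bound_of_continuousOn hf.continuousOn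
  refine ⟨max M 0, le_max_right _ _, fun a b e u ha hb he hu => (hM _ ?_).trans (le_max_left _ _)⟩
  exact ⟨abs_le.mp ha, abs_le.mp hb, abs_le.mp he, abs_le.mp hu⟩

/-- The polynomial `t ^ 5 - g ^ 2 (t ^ 3 + a t ^ 2 + b t + e)` is expanding for `t` of order
at least `g`. -/
theorem quintic_difference {a b e K g p θ : ℝ} (ha : |a| ≤ K) (hb : |b| ≤ K) (hK : 1 ≤ K)
    (hg : 96 * K ≤ θ) (hθ : g / 2 ≤ θ) (hg0 : 0 < g) (hp1 : g / 2 ≤ p) (hp2 : p ≤ 2 * g)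
    (hp3 : |p ^ 2 - g ^ 2| ≤ g ^ 2 / 336) :
    |p - θ| * (g ^ 4 / 32) ≤ |p ^ 5 - g ^ 2 * (p ^ 3 + a * p ^ 2 + b * p + e)| +
      |θ ^ 5 - g ^ 2 * (θ ^ 3 + a * θ ^ 2 + b * θ + e)| := by
  have hθ0 : 0 < θ := by linarith
  have hp0 : 0 < p := by linarith
  have hθ1 : 1 ≤ θ := by linarith
  -- Ψ is the divided difference of the quintic. Its term θ⁴ dominates: the two terms of uncertain
  -- sign cost at most θ⁴/4 each, and θ⁴/2 ≥ g⁴/32.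
  obtain ⟨Ψ, hΨ⟩ : ∃ Ψ, Ψ = p ^ 4 + p ^ 3 * θ + p ^ 2 * θ ^ 2 + p * θ ^ 3 + θ ^ 4 -
    g ^ 2 * (p ^ 2 + p * θ + θ ^ 2 + a * (p + θ) + b) := ⟨_, rfl⟩
  have hfac : (p - θ) * Ψ = (p ^ 5 - g ^ 2 * (p ^ 3 + a * p ^ 2 + b * p + e)) -
      (θ ^ 5 - g ^ 2 * (θ ^ 3 + a * θ ^ 2 + b * θ + e)) := by
    rw [hΨ]
    ring
  have hg2 : g ^ 2 ≤ 4 * θ ^ 2 := by nlinarith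
  have hp4 : p ≤ 4 * θ := by linarith
  have hlow : g ^ 4 / 32 ≤ Ψ := by
    have h1 : Ψ = (p ^ 2 - g ^ 2) * (p ^ 2 + p * θ + θ ^ 2) + p * θ ^ 3 + θ ^ 4 -
        g ^ 2 * (a * (p + θ) + b) := by
      rw [hΨ]
      ring
    have h2 : p ^ 2 + p * θ + θ ^ 2 ≤ 21 * θ ^ 2 := by nlinarith
    have h3 : -(g ^ 2 / 336 * (21 * θ ^ 2)) ≤ (p ^ 2 - g ^ 2) * (p ^ 2 + p * θ + θ ^ 2) := by
      have := mul_le_mul hp3 h2 (by positivity) (by positivity)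
      have h' := neg_abs_le ((p ^ 2 - g ^ 2) * (p ^ 2 + p * θ + θ ^ 2))
      rw [abs_mul, abs_of_pos (by positivity : 0 < p ^ 2 + p * θ + θ ^ 2)] at h'
      linarith
    have h4 : g ^ 2 / 336 * (21 * θ ^ 2) ≤ θ ^ 4 / 4 := by nlinarith [sq_nonneg θ]
    have h5 : a * (p + θ) + b ≤ 6 * K * θ := by
      have h6 : a * (p + θ) ≤ K * (5 * θ) :=
        mul_le_mul ((le_abs_self a).trans ha) (by linarith) (by linarith) (by linarith)
      have h7 : b ≤ K * θ := ((le_abs_self b).trans hb).trans (by nlinarith)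
      linarith
    have h6 : g ^ 2 * (a * (p + θ) + b) ≤ θ ^ 4 / 4 := by
      have h7 : g ^ 2 * (a * (p + θ) + b) ≤ g ^ 2 * (6 * K * θ) :=
        mul_le_mul_of_nonneg_left h5 (sq_nonneg g)
      have h8 : g ^ 2 * (6 * K * θ) ≤ 4 * θ ^ 2 * (6 * K * θ) :=
        mul_le_mul_of_nonneg_right hg2 (by positivity)
      have h9 : 4 * θ ^ 2 * (6 * K * θ) ≤ θ ^ 4 / 4 := by
        have := mul_le_mul_of_nonneg_left hg (by positivity : 0 ≤ θ ^ 3)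
        linarith
      linarith
    have h7 : g ^ 4 ≤ 16 * θ ^ 4 := by nlinarith [sq_nonneg g, sq_nonneg θ]
    have h8 : 0 ≤ p * θ ^ 3 := by positivity
    linarith
  have h1 : |p - θ| * (g ^ 4 / 32) ≤ |(p - θ) * Ψ| := by
    rw [abs_mul]
    exact mul_le_mul_of_nonneg_left (hlow.trans (le_abs_self _)) (abs_nonneg _)
  rw [hfac] at h1
  exact h1.trans (abs_sub _ _)

/-- Asymptotic expansion of the root of `t ^ 5 = g ^ 2 (t ^ 3 + a t ^ 2 + b t + e)` close to `g`,
for an approximate root. -/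
theorem quintic_root_asymptotics {K : ℝ} (hK : 1 ≤ K) :
    ∃ C g₀ : ℝ, ∀ a b e g θ : ℝ, |a| ≤ K → |b| ≤ K → |e| ≤ K → g₀ ≤ g → g / 2 ≤ θ →
      |θ ^ 5 - g ^ 2 * (θ ^ 3 + a * θ ^ 2 + b * θ + e)| ≤ K * g →
      |θ - (g + a / 2 + (b / 2 - 3 * a ^ 2 / 8) / g +
        (e / 2 - 2 * a * (b / 2 - 3 * a ^ 2 / 8) - a ^ 3 / 4) / g ^ 2)| ≤ C * (1 / g ^ 3) := by
  -- c and d are the coefficients of g⁻¹ and g⁻² in the root. They make every order below u⁴ vanish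
  -- when g + y is substituted into the quintic divided by g⁵; R is the remaining cofactor of u⁴.
  let c : ℝ → ℝ → ℝ := fun a b => b / 2 - 3 * a ^ 2 / 8
  let d : ℝ → ℝ → ℝ → ℝ := fun a b e => e / 2 - 2 * a * (b / 2 - 3 * a ^ 2 / 8) - a ^ 3 / 4
  let z : ℝ × ℝ × ℝ × ℝ → ℝ := fun q => c q.1 q.2.1 + d q.1 q.2.1 q.2.2.1 * q.2.2.2
  let y : ℝ × ℝ × ℝ × ℝ → ℝ := fun q => q.1 / 2 + z q * q.2.2.2
  let R : ℝ × ℝ × ℝ × ℝ → ℝ := fun q => 5 * q.1 * d q.1 q.2.1 q.2.2.1 + 7 * z q ^ 2 +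
    9 * z q * (y q ^ 2 + y q * (q.1 / 2) + q.1 ^ 2 / 4) - q.1 * z q * (y q + q.1 / 2) -
    q.2.1 * z q + 5 * y q ^ 4 + q.2.2.2 * y q ^ 5
  obtain ⟨B, hB0, hB⟩ := exists_abs_le_of_continuous (f := y) (by fun_prop) K
  obtain ⟨M, hM0, hM⟩ := exists_abs_le_of_continuous (f := R) (by fun_prop) K
  -- 192K yields 96K ≤ g/2 ≤ θ, and 2000B ≤ g keeps the approximate root p within the window around
  -- g of `quintic_difference`.
  refine ⟨32 * (M + K), 192 * K + 2000 * (B + 1), ?_⟩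
  intro a b e g θ ha hb he hg hθ hroot
  have hg1 : 1 ≤ g := by linarith
  have hg0 : 0 < g := by linarith
  obtain ⟨u, hu⟩ : ∃ u, u = 1 / g := ⟨_, rfl⟩
  have hgu : g * u = 1 := by rw [hu]; field_simp
  have hu0 : 0 < u := by rw [hu]; positivity
  have hu1 : |u| ≤ 1 := by
    rw [abs_of_pos hu0, hu, div_le_one hg0]
    exact hg1
  have hyB := hB a b e u ha hb he hu1
  have hRM := hM a b e u ha hb he hu1
  obtain ⟨Y, hY⟩ : ∃ Y, Y = y (a, b, e, u) := ⟨_, rfl⟩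
  obtain ⟨p, hp⟩ : ∃ p, p = g + Y := ⟨_, rfl⟩
  have hpe : g + a / 2 + (b / 2 - 3 * a ^ 2 / 8) / g +
        (e / 2 - 2 * a * (b / 2 - 3 * a ^ 2 / 8) - a ^ 3 / 4) / g ^ 2 = p := by
    rw [hp, hY]
    simp only [y, z, c, d, hu]
    field_simp
    ring
  rw [← hY] at hyB
  obtain ⟨hY1, hY2⟩ := abs_le.mp hyB
  have hBg : 2000 * B ≤ g := by linarith
  have hp1 : g / 2 ≤ p := by linarith
  have hp2 : p ≤ 2 * g := by linarith
  have hp3 : |p ^ 2 - g ^ 2| ≤ g ^ 2 / 336 := by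
    have h1 : p ^ 2 - g ^ 2 = Y * (p + g) := by
      rw [hp]
      ring
    rw [h1, abs_mul, abs_of_pos (by linarith : 0 < p + g)]
    have h2 := mul_le_mul hyB (by linarith : p + g ≤ 3 * g) (by linarith) hB0
    have h3 := mul_le_mul_of_nonneg_right hBg hg0.le
    linarith [sq_nonneg g]
  have hPhi : p ^ 5 - g ^ 2 * (p ^ 3 + a * p ^ 2 + b * p + e) = g * R (a, b, e, u) := by
    have h1 : p ^ 5 - g ^ 2 * (p ^ 3 + a * p ^ 2 + b * p + e) =
        g ^ 5 * ((1 + u * Y) ^ 5 - (1 + u * Y) ^ 3 - a * u * (1 + u * Y) ^ 2 -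
          b * u ^ 2 * (1 + u * Y) - e * u ^ 3) := by
      rw [hp, hu]
      field_simp
      ring
    have h2 : (1 + u * Y) ^ 5 - (1 + u * Y) ^ 3 - a * u * (1 + u * Y) ^ 2 -
          b * u ^ 2 * (1 + u * Y) - e * u ^ 3 = u ^ 4 * R (a, b, e, u) := by
      rw [hY]
      simp only [R, y, z, c, d]
      ring
    rw [h1, h2]
    linear_combination g * R (a, b, e, u) * ((g * u) ^ 3 + (g * u) ^ 2 + g * u + 1) * hgu
  have hdiff := quintic_difference (e := e) ha hb hK (by linarith) hθ hg0 hp1 hp2 hp3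
  rw [hPhi, abs_mul, abs_of_pos hg0] at hdiff
  rw [hpe, abs_sub_comm]
  have h1 : |p - θ| * (g ^ 4 / 32) ≤ g * (M + K) := by
    have := mul_le_mul_of_nonneg_left hRM hg0.le
    linarith
  rw [mul_one_div, le_div_iff₀ (by positivity)]
  have h2 : |p - θ| * g ^ 3 * g ≤ 32 * (M + K) * g := by linarith
  exact le_of_mul_le_mul_right h2 hg0

end Asymptotics

/-! ### Walk counts -/

section Walks

variable {U : Type*} [Fintype U] [DecidableEq U]

theorem abs_adj_pow_mulVec_le (H : SimpleGraph U) {B : ℝ} (v : U → ℝ) (hv : ∀ u, |v u| ≤ B)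
    (j : ℕ) (u : U) : |(adj H ^ j *ᵥ v) u| ≤ (Fintype.card U : ℝ) ^ j * B := by
  induction j generalizing u with
  | zero => simpa using hv u
  | succ j ih =>
    rw [pow_succ', ← Matrix.mulVec_mulVec, Matrix.mulVec, dotProduct]
    calc |∑ w, adj H u w * (adj H ^ j *ᵥ v) w|
        ≤ ∑ w : U, (Fintype.card U : ℝ) ^ j * B := by
          refine (Finset.abs_sum_le_sum_abs _ _).trans (Finset.sum_le_sum fun w _ => ?_)
          rw [abs_mul, abs_of_nonneg (adj_nonneg H u w)]
          exact (mul_le_of_le_one_left (abs_nonneg _) (adj_le_one H u w)).trans (ih w)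
      _ = _ := by
        rw [Finset.sum_const, nsmul_eq_mul, Finset.card_univ]
        ring

theorem abs_ones_dotProduct_le (H : SimpleGraph U) {B : ℝ} (v : U → ℝ) (hv : ∀ u, |v u| ≤ B)
    (j : ℕ) : |(fun _ : U => (1 : ℝ)) ⬝ᵥ (adj H ^ j *ᵥ v)| ≤ (Fintype.card U : ℝ) ^ (j + 1) * B := by
  rw [dotProduct]
  calc _ ≤ ∑ w : U, (Fintype.card U : ℝ) ^ j * B := by
        refine (Finset.abs_sum_le_sum_abs _ _).trans (Finset.sum_le_sum fun w _ => ?_)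
        rw [one_mul]
        exact abs_adj_pow_mulVec_le H v hv j w
    _ = _ := by
      rw [Finset.sum_const, nsmul_eq_mul, Finset.card_univ]
      ring

theorem abs_onesForm_le (H : SimpleGraph U) (j : ℕ) :
    |onesForm H j| ≤ (Fintype.card U : ℝ) ^ (j + 1) := by
  have h := abs_ones_dotProduct_le H (B := 1) (fun _ => 1) (by simp) j
  rwa [mul_one] at h

theorem onesForm_zero (H : SimpleGraph U) : onesForm H 0 = Fintype.card U := by
  simp [onesForm, dotProduct]

/-- Expansion of the total weight of a solution of `θ p = A p + c 1` in terms of walk counts. -/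
theorem walk_expansion (H : SimpleGraph U) {θ c : ℝ} {p : U → ℝ}
    (hp : ∀ u, θ * p u = (adj H *ᵥ p) u + c) :
    θ ^ 4 * ∑ u, p u = (fun _ : U => (1 : ℝ)) ⬝ᵥ (adj H ^ 4 *ᵥ p) +
      c * (θ ^ 3 * onesForm H 0 + θ ^ 2 * onesForm H 1 + θ * onesForm H 2 + onesForm H 3) := by
  have hvec : θ • p = adj H *ᵥ p + c • fun _ : U => (1 : ℝ) := by
    funext u
    simp [hp u]
  have step : ∀ j, θ * ((fun _ : U => (1 : ℝ)) ⬝ᵥ (adj H ^ j *ᵥ p)) =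
      (fun _ : U => (1 : ℝ)) ⬝ᵥ (adj H ^ (j + 1) *ᵥ p) + c * onesForm H j := by
    intro j
    rw [← smul_eq_mul, ← dotProduct_smul, ← Matrix.mulVec_smul, hvec, Matrix.mulVec_add,
      Matrix.mulVec_mulVec, ← pow_succ, Matrix.mulVec_smul, dotProduct_add, dotProduct_smul,
      smul_eq_mul, onesForm]
  have h0 : ∑ u, p u = (fun _ : U => (1 : ℝ)) ⬝ᵥ (adj H ^ 0 *ᵥ p) := by
    simp [dotProduct]
  rw [h0]
  linear_combination θ ^ 3 * step 0 + θ ^ 2 * step 1 + θ * step 2 + step 3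

/-- At an entry of maximal modulus the adjacency term is at most |U| times that modulus, hence at
most half of the left side. -/
theorem abs_sup_le_of_eq (H : SimpleGraph U) {θ c : ℝ} {p : U → ℝ}
    (hθ : 2 * (Fintype.card U : ℝ) ≤ |θ|) (hθ0 : θ ≠ 0)
    (hp : ∀ u, θ * p u = (adj H *ᵥ p) u + c) (u : U) : |p u| ≤ 2 * |c| / |θ| := by
  have hθa : 0 < |θ| := abs_pos.mpr hθ0
  have : Nonempty U := ⟨u⟩
  obtain ⟨w, hw⟩ := Finite.exists_max fun v => |p v|
  refine (hw u).trans ?_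
  have h1 := abs_adj_pow_mulVec_le H p hw 1 w
  rw [pow_one, pow_one] at h1
  have h2 : |θ| * |p w| ≤ Fintype.card U * |p w| + |c| := by
    rw [← abs_mul, hp w]
    exact (abs_add_le _ _).trans (add_le_add_left h1 _)
  have h3 := mul_le_mul_of_nonneg_right hθ (abs_nonneg (p w))
  rw [le_div_iff₀ hθa]
  linarith

end Walks

/-! ### The quintic satisfied by eigenvalues of a join -/

section JoinEigenvalues

theorem adj_induce {V : Type*} (G : SimpleGraph V) (S : Set V) (u v : S) :
    adj (G.induce S) u v = adj G u v := by
  by_cases h : G.Adj u v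
  · rw [adj_of_adj h, adj_of_adj (G := G.induce S) (u := u) (v := v) h]
  · rw [adj_of_not_adj h, adj_of_not_adj (G := G.induce S) (u := u) (v := v) h]

/-- The eigenvalues of large modulus of a join with an independent set are approximate roots of a
quintic polynomial. -/
theorem join_eigenvalue_approx {n k : ℕ} {G : SimpleGraph (Fin n)} {L : Finset (Fin n)}
    (hL : L.card = k) (hk : 1 ≤ k) (hLR : ∀ v ∉ L, ∀ u ∈ L, G.Adj v u)
    (hR : ∀ v ∉ L, ∀ w ∉ L, ¬ G.Adj v w) {θ : ℝ} {x : Fin n → ℝ} (hx : x ≠ 0)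
    (hθ : adj G *ᵥ x = θ • x) (hθ2 : 2 * (k : ℝ) ≤ |θ|) :
    |θ ^ 5 - Lᶜ.card * (θ ^ 3 * k + θ ^ 2 * ell G L 1 + θ * ell G L 2 + ell G L 3)| ≤
      2 * k ^ 5 * Lᶜ.card / |θ| := by
  have hkR : (1 : ℝ) ≤ k := by exact_mod_cast hk
  have hθa : 0 < |θ| := by linarith
  have hθ0 : θ ≠ 0 := abs_pos.mp hθa
  obtain ⟨m, hm⟩ : ∃ m : ℝ, m = Lᶜ.card := ⟨_, rfl⟩
  have hm0 : 0 ≤ m := hm ▸ Nat.cast_nonneg _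
  rw [← hm]
  obtain ⟨s, hs⟩ : ∃ s, s = ∑ u ∈ L, x u := ⟨_, rfl⟩
  have heq : ∀ v, θ * x v = ∑ u ∈ L, adj G v u * x u + ∑ w ∈ Lᶜ, adj G v w * x w := by
    intro v
    have := congrFun hθ v
    rw [Pi.smul_apply, smul_eq_mul, Matrix.mulVec, dotProduct, ← Finset.sum_add_sum_compl L] at this
    exact this.symm
  have hxR : ∀ v ∉ L, θ * x v = s := by
    intro v hv
    rw [heq v, hs]
    have h1 : ∑ w ∈ Lᶜ, adj G v w * x w = 0 := Finset.sum_eq_zero fun w hw => by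
      rw [adj_of_not_adj (hR v hv w (Finset.mem_compl.mp hw)), zero_mul]
    rw [h1, add_zero]
    exact Finset.sum_congr rfl fun u hu => by rw [adj_of_adj (hLR v hv u hu), one_mul]
  -- Each of the m vertices off L carries s/θ, so together they act on L as the constant c.
  obtain ⟨c, hc⟩ : ∃ c, c = m * s / θ := ⟨_, rfl⟩
  have hxL : ∀ u ∈ L, θ * x u = ∑ w ∈ L, adj G u w * x w + c := by
    intro u hu
    rw [heq u]
    congr 1
    rw [hc, hm, mul_div_assoc, ← nsmul_eq_mul, ← Finset.sum_const]
    refine Finset.sum_congr rfl fun w hw => ?_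
    rw [adj_of_adj (hLR w (Finset.mem_compl.mp hw) u hu).symm, one_mul, eq_div_iff hθ0, mul_comm]
    exact hxR w (Finset.mem_compl.mp hw)
  have hsub : ∀ f : Fin n → ℝ, ∑ u : (L : Set (Fin n)), f u = ∑ u ∈ L, f u := fun f =>
    (Finset.sum_subtype L (fun _ => Iff.rfl) f).symm
  have hcard : (Fintype.card (L : Set (Fin n)) : ℝ) = k := by
    have : Fintype.card (L : Set (Fin n)) = k := by simp [hL]
    rw [this]
  obtain ⟨p, hp⟩ : ∃ p : ↥(L : Set (Fin n)) → ℝ, p = fun u => x u.1 := ⟨_, rfl⟩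
  have hpe : ∀ u, θ * p u = (adj (G.induce (L : Set (Fin n))) *ᵥ p) u + c := by
    intro u
    rw [hp, hxL u u.2, Matrix.mulVec, dotProduct]
    congr 1
    rw [← hsub fun w => adj G u w * x w]
    exact Finset.sum_congr rfl fun w _ => by rw [adj_induce]
  have hps : ∑ u, p u = s := by
    rw [hs, hp]
    exact hsub x
  have hexp := walk_expansion _ hpe
  rw [hps, onesForm_zero, hcard] at hexp
  have hsup := abs_sup_le_of_eq _ (by rw [hcard]; exact hθ2) hθ0 hpe
  have hq := abs_ones_dotProduct_le (G.induce (L : Set (Fin n))) p hsup 4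
  rw [hcard] at hq
  -- If s = 0 then c = 0, so x vanishes on L by the sup bound and off L by its equation. The final
  -- inequality is divided by |s|.
  have hs0 : s ≠ 0 := by
    intro h0
    have hc0 : c = 0 := by rw [hc, h0, mul_zero, zero_div]
    refine hx (funext fun v => ?_)
    by_cases hv : v ∈ L
    · have := hsup ⟨v, hv⟩
      rw [hc0, hp, abs_zero, mul_zero, zero_div] at this
      exact abs_nonpos_iff.mp this
    · have := hxR v hv
      rw [h0] at this
      exact (mul_eq_zero.mp this).resolve_left hθ0
  obtain ⟨q, hqdef⟩ : ∃ q, q = (fun _ : (L : Set (Fin n)) => (1 : ℝ)) ⬝ᵥ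
    (adj (G.induce (L : Set (Fin n))) ^ 4 *ᵥ p) := ⟨_, rfl⟩
  rw [← hqdef] at hexp hq
  change θ ^ 4 * s = q + c * (θ ^ 3 * k + θ ^ 2 * ell G L 1 + θ * ell G L 2 + ell G L 3) at hexp
  have hcθ : c * θ = m * s := by rw [hc]; field_simp
  have hfin : (θ ^ 5 - m * (θ ^ 3 * k + θ ^ 2 * ell G L 1 + θ * ell G L 2 + ell G L 3)) * s =
      θ * q := by
    linear_combination θ * hexp +
      (θ ^ 3 * k + θ ^ 2 * ell G L 1 + θ * ell G L 2 + ell G L 3) * hcθ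
  have hca : |c| * |θ| = m * |s| := by
    rw [← abs_mul, hcθ, abs_mul, abs_of_nonneg hm0]
  have hsa : 0 < |s| := abs_pos.mpr hs0
  have h1 := congrArg abs hfin
  rw [abs_mul, abs_mul] at h1
  refine le_of_mul_le_mul_right ?_ hsa
  rw [h1]
  calc |θ| * |q| ≤ |θ| * (k ^ (4 + 1) * (2 * |c| / |θ|)) :=
        mul_le_mul_of_nonneg_left hq hθa.le
    _ = 2 * k ^ 5 * |c| := by
      field_simp
      ring
    _ = 2 * k ^ 5 * (|c| * |θ|) / |θ| := by field_simp
    _ = 2 * k ^ 5 * m / |θ| * |s| := by rw [hca]; field_simp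

end JoinEigenvalues

/-! ### Join decompositions and the spread of a join -/

section Decomposition

theorem join_adj_inl_inl {V W : Type*} (G : SimpleGraph V) (H : SimpleGraph W) (a b : V) :
    (join G H).Adj (Sum.inl a) (Sum.inl b) ↔ G.Adj a b := by
  simp [join]

theorem join_adj_inl_inr {V W : Type*} (G : SimpleGraph V) (H : SimpleGraph W) (a : V) (b : W) :
    (join G H).Adj (Sum.inl a) (Sum.inr b) := by
  simp [join]

theorem join_adj_inr_inl {V W : Type*} (G : SimpleGraph V) (H : SimpleGraph W) (a : V) (b : W) :
    (join G H).Adj (Sum.inr b) (Sum.inl a) := by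
  simp [join]

theorem join_adj_inr_inr {V W : Type*} (G : SimpleGraph V) (H : SimpleGraph W) (a b : W) :
    (join G H).Adj (Sum.inr a) (Sum.inr b) ↔ H.Adj a b := by
  simp [join]

theorem isJoinDecomposition_iff {r n : ℕ} (G : SimpleGraph (Fin n)) (L : Finset (Fin n)) :
    IsJoinDecomposition r G L ↔ L.card = r - 2 ∧ (∀ v ∉ L, ∀ u ∈ L, G.Adj v u) ∧
      ∀ v ∉ L, ∀ w ∉ L, ¬ G.Adj v w := by
  constructor
  · rintro ⟨hL, e, he⟩
    have hout : ∀ v ∉ L, ∃ j, e (Sum.inr j) = v := by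
      intro v hv
      obtain ⟨y | j, hy⟩ := e.surjective v
      · rw [he] at hy
        exact absurd (hy ▸ y.2) hv
      · exact ⟨j, hy⟩
    refine ⟨hL, fun v hv u hu => ?_, fun v hv w hw => ?_⟩
    · obtain ⟨j, rfl⟩ := hout v hv
      rw [show u = e (Sum.inl ⟨u, hu⟩) from (he ⟨u, hu⟩).symm, e.map_adj_iff]
      exact join_adj_inr_inl _ _ _ _
    · obtain ⟨i, rfl⟩ := hout v hv
      obtain ⟨j, rfl⟩ := hout w hw
      rw [e.map_adj_iff, join_adj_inr_inr]
      simp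
  · rintro ⟨hL, h1, h2⟩
    refine ⟨hL, ?_⟩
    have hcard : Fintype.card {v : Fin n // ¬ v ∈ L} = n - (r - 2) := by
      rw [Fintype.card_subtype_compl, Fintype.card_fin, Fintype.card_coe, hL]
    let f : Fin (n - (r - 2)) ≃ {v : Fin n // ¬ v ∈ L} := (Fintype.equivFinOfCardEq hcard).symm
    let g : (L : Set (Fin n)) ⊕ Fin (n - (r - 2)) ≃ Fin n :=
      (Equiv.sumCongr (Equiv.refl {v : Fin n // v ∈ L}) f).trans (Equiv.sumCompl fun v => v ∈ L)
    have hgl : ∀ x : (L : Set (Fin n)), g (Sum.inl x) = x := fun x => rfl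
    have hgr : ∀ j, g (Sum.inr j) ∉ L := fun j => (f j).2
    refine ⟨⟨g, ?_⟩, hgl⟩
    rintro (a | a) (b | b)
    · rw [join_adj_inl_inl, hgl, hgl]
      rfl
    · exact iff_of_true (h1 _ (hgr b) _ a.2).symm (join_adj_inl_inr _ _ _ _)
    · exact iff_of_true (h1 _ (hgr a) _ b.2) (join_adj_inr_inl _ _ _ _)
    · rw [join_adj_inr_inr]
      exact iff_of_false (h2 _ (hgr a) _ (hgr b)) (by simp)

theorem joinOn_eq_self {V : Type*} {G : SimpleGraph V} {L : Finset V}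
    (h1 : ∀ v ∉ L, ∀ u ∈ L, G.Adj v u) (h2 : ∀ v ∉ L, ∀ w ∉ L, ¬ G.Adj v w) :
    joinOn G L = G := by
  ext a b
  have e1 := h1 a
  have e2 := h1 b
  have e3 := h2 a
  have e4 := G.adj_comm a b
  simp only [joinOn]
  by_cases ha : a ∈ L <;> by_cases hb : b ∈ L
  · simp [ha, hb]
  · simp [ha, hb, e4, e2 hb a ha]
  · simp [ha, hb, e1 ha b hb]
  · simp [ha, hb, e3 ha b hb]

/-- Asymptotic expansion of the spread of the join of a graph on `k` vertices with a large
independent set. -/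
theorem spread_join_asymptotics {k : ℕ} (hk : 1 ≤ k) :
    ∃ (C : ℝ) (N : ℕ), ∀ n ≥ N, ∀ (G : SimpleGraph (Fin n)) (L : Finset (Fin n)), L.card = k →
      (∀ v ∉ L, ∀ u ∈ L, G.Adj v u) → (∀ v ∉ L, ∀ w ∉ L, ¬ G.Adj v w) →
      |spread G - (2 * √((k : ℝ) * (n - k)) + (ell G L 2 / k - 3 / 4 * (ell G L 1 / k) ^ 2) /
        √((k : ℝ) * (n - k)))| ≤ C * (1 / √((k : ℝ) * (n - k)) ^ 3) := by
  have hkR : (1 : ℝ) ≤ k := by exact_mod_cast hk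
  have hk4 : (1 : ℝ) ≤ k ^ 4 := one_le_pow₀ hkR
  -- 4k⁴ bounds the normalised walk counts ℓ_j/k and also, as factor of g, the residual 2k⁵(n-k)/θ
  -- for θ ≥ g/2.
  obtain ⟨C, g₀, hC⟩ := quintic_root_asymptotics (K := 4 * (k : ℝ) ^ 4) (by linarith)
  refine ⟨2 * C, k + 1 + ⌈(|g₀| + 4 * k) ^ 2⌉₊, fun n hn G L hL h1 h2 => ?_⟩
  have hnk : (n : ℝ) - k ≥ (|g₀| + 4 * k) ^ 2 := by
    have e1 : (|g₀| + 4 * (k : ℝ)) ^ 2 ≤ ⌈(|g₀| + 4 * (k : ℝ)) ^ 2⌉₊ := Nat.le_ceil _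
    have e2 : (k : ℝ) + 1 + ⌈(|g₀| + 4 * (k : ℝ)) ^ 2⌉₊ ≤ n := by exact_mod_cast hn
    linarith
  have hkn : k < n := by omega
  have hnk0 : (0 : ℝ) < n - k := by
    rw [sub_pos]
    exact_mod_cast hkn
  have : Nonempty (Fin n) := ⟨⟨0, by omega⟩⟩
  have hLc : Lᶜ.card = n - k := by rw [Finset.card_compl, Fintype.card_fin, hL]
  have hLcR : (Lᶜ.card : ℝ) = n - k := by rw [hLc, Nat.cast_sub hkn.le]
  obtain ⟨g, hg⟩ : ∃ g, g = √((k : ℝ) * (n - k)) := ⟨_, rfl⟩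
  have hg2 : g ^ 2 = k * (n - k) := hg ▸ Real.sq_sqrt (by positivity)
  have hgbig : |g₀| + 4 * k ≤ g := by
    rw [hg]
    apply Real.le_sqrt_of_sq_le
    have := mul_le_mul_of_nonneg_right hkR hnk0.le
    linarith
  have hgg₀ : g₀ ≤ g := by
    have := le_abs_self g₀
    linarith
  have hg4k : 4 * k ≤ g := by
    have := abs_nonneg g₀
    linarith
  have hg0 : 0 < g := by linarith
  -- These bounds put the top eigenvalue and minus the bottom one above g/2, which singles out the
  -- root near g.
  obtain ⟨b1, b2⟩ := joinOn_extreme_bounds G L (by omega) (by omega)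
  rw [joinOn_eq_self h1 h2, hL, hLcR, ← hg] at b1 b2
  have he0 : 0 ≤ ∑ u ∈ L, ∑ v ∈ L, adj G u v :=
    Finset.sum_nonneg fun u _ => Finset.sum_nonneg fun v _ => adj_nonneg G u v
  have he1 : ∑ u ∈ L, ∑ v ∈ L, adj G u v ≤ (k : ℝ) ^ 2 := by
    calc _ ≤ ∑ u ∈ L, ∑ v ∈ L, (1 : ℝ) :=
          Finset.sum_le_sum fun u _ => Finset.sum_le_sum fun v _ => adj_le_one G u v
      _ = _ := by simp [hL, sq]
  have he2 : (∑ u ∈ L, ∑ v ∈ L, adj G u v) / (2 * k) ≤ k / 2 := by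
    rw [div_le_div_iff₀ (by positivity) (by norm_num)]
    linarith
  have he3 : 0 ≤ (∑ u ∈ L, ∑ v ∈ L, adj G u v) / (2 * k) := by positivity
  obtain ⟨l, hl⟩ : ∃ l, l = sSup (spectrum ℝ (adj G)) := ⟨_, rfl⟩
  obtain ⟨m, hm⟩ : ∃ m, m = -sInf (spectrum ℝ (adj G)) := ⟨_, rfl⟩
  have hlg : g / 2 ≤ l := by linarith
  have hmg : g / 2 ≤ m := by linarith
  have hA := adj_isHermitian G
  obtain ⟨x, hx, hx'⟩ := exists_eigenvector_sSup hA
  obtain ⟨y, hy, hy'⟩ := exists_eigenvector_sInf hA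
  rw [← hl] at hx'
  rw [← neg_neg (sInf _), ← hm] at hy'
  have al := join_eigenvalue_approx hL hk h1 h2 hx hx'
    (by rw [abs_of_pos (by linarith)]; linarith)
  have am := join_eigenvalue_approx hL hk h1 h2 hy hy'
    (by rw [abs_neg, abs_of_pos (by linarith)]; linarith)
  rw [abs_of_pos (by linarith : 0 < l), hLcR] at al
  rw [abs_neg, abs_of_pos (by linarith : 0 < m), hLcR] at am
  have hres : ∀ t : ℝ, g / 2 ≤ t → 2 * (k : ℝ) ^ 5 * (n - k) / t ≤ 4 * k ^ 4 * g := by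
    intro t ht
    rw [div_le_iff₀ (by linarith)]
    have e1 : 2 * (k : ℝ) ^ 5 * (n - k) = 4 * k ^ 4 * g * (g / 2) := by
      linear_combination (-2 * (k : ℝ) ^ 4) * hg2
    rw [e1]
    exact mul_le_mul_of_nonneg_left ht (by positivity)
  have hell : ∀ j : ℕ, j ≤ 4 → |ell G L j / k| ≤ 4 * (k : ℝ) ^ 4 := by
    intro j hj
    have e1 := abs_onesForm_le (G.induce (L : Set (Fin n))) j
    have e2 : Fintype.card (L : Set (Fin n)) = k := by simp [hL]
    rw [e2] at e1
    rw [abs_div, abs_of_pos (by linarith : (0 : ℝ) < k), div_le_iff₀ (by linarith)]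
    have e3 : (k : ℝ) ^ (j + 1) ≤ k ^ 5 := pow_le_pow_right₀ hkR (by omega)
    have e4 : (0 : ℝ) ≤ k ^ 5 := by positivity
    calc |ell G L j| ≤ (k : ℝ) ^ (j + 1) := e1
      _ ≤ 4 * (k : ℝ) ^ 4 * k := by linarith
  have rl := hC (ell G L 1 / k) (ell G L 2 / k) (ell G L 3 / k) g l (hell 1 (by norm_num))
    (hell 2 (by norm_num)) (hell 3 (by norm_num)) hgg₀ hlg (by
      refine le_trans (le_of_eq ?_) (al.trans (hres l hlg))
      congr 1
      rw [hg2]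
      field_simp)
  -- Substituting θ = -m flips the signs of the ℓ₁ and ℓ₃ coefficients.
  have rm := hC (-(ell G L 1 / k)) (ell G L 2 / k) (-(ell G L 3 / k)) g m
    (by rw [abs_neg]; exact hell 1 (by norm_num)) (hell 2 (by norm_num))
    (by rw [abs_neg]; exact hell 3 (by norm_num)) hgg₀ hmg (by
      refine le_trans (le_of_eq ?_) (am.trans (hres m hmg))
      rw [← abs_neg]
      congr 1
      rw [hg2]
      field_simp
      ring)
  rw [← hg]
  -- The coefficients of g⁰ and g⁻² are odd in (ℓ₁, ℓ₃) and cancel, while those of g and g⁻¹ double.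
  have hsum := (abs_add_le _ _).trans (add_le_add rl rm)
  have hsp : spread G = l + m := by
    rw [spread, hl, hm]
    ring
  rw [hsp, two_mul C, add_mul]
  refine le_trans (le_of_eq ?_) hsum
  congr 1
  ring

end Decomposition

end SpreadMinor

/-! ### The main theorem -/

theorem lemma4p1 (r : ℕ) (hr : 3 ≤ r) :
    ∃ (C : ℝ) (N : ℕ), ∀ n : ℕ, N ≤ n → ∀ G : SimpleGraph (Fin n), IsMaxSpread r G →
      (∃ L : Finset (Fin n), IsJoinDecomposition r G L) ∧
      ∀ L : Finset (Fin n), IsJoinDecomposition r G L →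
        |spread G -
            (2 * gamma n r +
              1 / ((r : ℝ) - 2) *
                (-(3 / (4 * ((r : ℝ) - 2))) * ell G L 1 ^ 2 + ell G L 2) *
                (1 / gamma n r))|
          ≤ C * (1 / gamma n r ^ 3) := by
  obtain ⟨k, rfl⟩ : ∃ k, r = k + 2 := ⟨r - 2, by omega⟩
  have hk : 1 ≤ k := by omega
  have hk0 : (k : ℝ) ≠ 0 := by
    have : k ≠ 0 := by omega
    exact_mod_cast this
  obtain ⟨N₁, hN₁⟩ := exists_join_structure hk rfl
  obtain ⟨C, N₂, hN₂⟩ := spread_join_asymptotics hk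
  refine ⟨C, N₁ + N₂, fun n hn G hG => ⟨?_, fun L hL => ?_⟩⟩
  · obtain ⟨L, h0, h1, h2⟩ := hN₁ n (by omega) G hG
    exact ⟨L, (isJoinDecomposition_iff G L).mpr ⟨by simpa using h0, h1, h2⟩⟩
  · obtain ⟨h0, h1, h2⟩ := (isJoinDecomposition_iff G L).mp hL
    have h := hN₂ n (by omega) G L (by simpa using h0) h1 h2
    have e1 : ((k + 2 : ℕ) : ℝ) - 2 = k := by
      push_cast
      ring
    have hgamma : gamma n (k + 2) = √((k : ℝ) * (n - k)) := by
      rw [gamma, e1]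
      congr 2
      push_cast
      ring
    rw [hgamma, e1]
    refine le_trans (le_of_eq ?_) h
    congr 3
    rw [mul_one_div]
    congr 1
    field_simp
    ring
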